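/- Let $b$ be a prime, let $d\ge 1$ and $s,m,R\ge 0$ be integers, and let $P_{b^m}=\{\boldsymbol x_0,\dots,\boldsymbol x_{b^m-1}\}\subset[0,1)^s$ be the digital net over $\mathbb Z_b$ generated by matrices $C_1,\dots,C_s\in\mathbb Z_b^{R\times m}$. That is, if $n=\sum_{q<m}n_qb^q$ with digits $n_q$ and $(y_{n,i,1},\dots,y_{n,i,R})^\top=C_i(n_0,\dots,n_{m-1})^\top$, then $x_{n,i}=\sum_{j=1}^R y_{n,i,j}b^{-j}$. Notation. Base-$b$ expansions of numbers in $[0,1)$ are those with infinitely many digits different from $b-1$. The digit interlacing maps $\mathscr D_d:[0,1)^d\to[0,1)$ and $\mathscr D_d:\mathbb N_0^d\to\mathbb N_0$ are $$\mathscr D_d(x_1,\dots,x_d)=\sum_{a\ge1}\sum_{r=1}^d\xi_{r,a}b^{-r-(a-1)d},\qquad \mathscr D_d(k_1,\dots,k_d)=\sum_{a\ge0}\sum_{r=1}^d\kappa_{r,a}b^{r-1+ad},$$ where $x_r=\sum_{a\ge1}\xi_{r,a}b^{-a}$ and $k_r=\sum_{a\ge0}\kappa_{r,a}b^a$. They are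 applied to vectors of length $ds$ blockwise, to the $s$ consecutive blocks of length $d$. The first map is injective, and $\mathscr D_d^{-1}$ denotes its inverse on its range, which contains all $x_{n,i}$. For $k=\kappa_0+\dots+\kappa_{a-1}b^{a-1}\in\mathbb N_0$ and $x=\xi_1b^{-1}+\xi_2b^{-2}+\cdots\in[0,1)$ the Walsh function is $\mathrm{wal}_k(x)=\mathrm e^{2\pi \mathrm i(\kappa_0\xi_1+\dots+\kappa_{a-1}\xi_a)/b}$; for vectors, $\mathrm{wal}_{\boldsymbol k}(\boldsymbol x)=\prod_j\mathrm{wal}_{k_j}(x_j)$. Scrambling. Let $\boldsymbol\Pi=(\pi_{j,w})$, where $j\in\{1,\dots,ds\}$ and $w$ runs over all finite sequences in $\{0,\dots,b-1\}$, be mutually independent, uniformly distributed random permutations of $\{0,\dots,b-1\}$. Owen's scrambling $\boldsymbol z_{\boldsymbol\Pi}$ of $\boldsymbol z\in[0,1)^{ds}$ has $j$th coordinate $\sum_{k\ge1}\pi_{j,(\zeta_{j,1},\dots,\zeta_{j,k-1})}(\zeta_{j,k})\,b^{-k}$, where $z_j=\sum_{k\ge1}\zeta_{j,k}b^{-k}$.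 The order-$d$ scrambling of $P_{b^m}$ consists of the points $\boldsymbol y_n=\mathscr D_d\big(\mathscr D_d^{-1}(\boldsymbol x_n)_{\boldsymbol\Pi}\big)$, with the same $\boldsymbol\Pi$ for all $n$. Let $f:[0,1]^s\to\mathbb R$ be in $L_2([0,1]^s)$, with Walsh coefficients $\widehat f(\boldsymbol k)=\int_{[0,1]^s}f(\boldsymbol x)\overline{\mathrm{wal}_{\boldsymbol k}(\boldsymbol x)}\,\mathrm d\boldsymbol x$, and let $\widehat I(f)=b^{-m}\sum_{n=0}^{b^m-1}f(\boldsymbol y_n)$. For $\boldsymbol\ell=(l_1,\dots,l_{ds})\in\mathbb N_0^{ds}$ let $$B_{d,\boldsymbol\ell,s}=\{\boldsymbol k\in\mathbb N_0^{ds}:\lfloor b^{l_j-1}\rfloor\le k_j<b^{l_j}\text{ for }1\le j\le ds\},\qquad \sigma^2_{d,\boldsymbol\ell,s}(f)=\sum_{\boldsymbol k\in B_{d,\boldsymbol\ell,s}}\big|\widehat f(\mathscr D_d(\boldsymbol k))\big|^2,$$ and, for an arbitrarily chosen $\boldsymbol k\in B_{d,\boldsymbol\ell,s}$ with consecutive blocks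 $\boldsymbol k_1,\dots,\boldsymbol k_s\in\mathbb N_0^d$, let the gain coefficient be $$\Gamma_{d,\boldsymbol\ell}(P_{b^m})=\frac1{b^{2m}}\sum_{n,n'=0}^{b^m-1}\prod_{i=1}^s\mathbb E\Big[\mathrm{wal}_{\boldsymbol k_i}\big(\mathscr D_d^{-1}(x_{n,i})_{\Pi_i}\big)\overline{\mathrm{wal}_{\boldsymbol k_i}\big(\mathscr D_d^{-1}(x_{n',i})_{\Pi_i}\big)}\Big],$$ where $\Pi_i$ is the $i$th block, of length $d$, of $\boldsymbol\Pi$. Then, whatever choices of $\boldsymbol k\in B_{d,\boldsymbol\ell,s}$ are made, $\widehat I(f)$ has a finite second moment and $$\mathrm{Var}[\widehat I(f)]=\sum_{\boldsymbol\ell\in\mathbb N_0^{ds}\setminus\{\boldsymbol0\}}\sigma^2_{d,\boldsymbol\ell,s}(f)\,\Gamma_{d,\boldsymbol\ell}(P_{b^m}),$$ the series converging unconditionally. -/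

import Mathlib

open MeasureTheory ProbabilityTheory

namespace OwenNet

/-! Coordinates of `[0,1)^s` are indexed by `Fin s`; the `d * s` coordinates with (one-based) index
`(i - 1) * d + r` are indexed by pairs `i : Fin s`, `r : Fin d`, that is, a vector of length `d * s`
is a function `Fin s → Fin d → _`.  `Real.digits x b k` is the coefficient of `b ^ (-(k + 1))` in
the base `b` expansion of `x ∈ [0,1)` in which infinitely many digits differ from `b - 1`, and
`Real.ofDigits a` is the sum of the series `∑ k, a k * b ^ (-(k + 1))`. -/

section Digits

/-- The digit interlacing function `[0,1)^d → [0,1)`: digit number `a * d + r` (counted from zero,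
with `r < d`) of the result is digit number `a` of the coordinate `r`. -/
noncomputable def interlace (b d : ℕ) [NeZero b] [NeZero d] (x : Fin d → ℝ) : ℝ :=
  Real.ofDigits fun k : ℕ => Real.digits (x (Fin.ofNat d k)) b (k / d)

/-- The inverse of the digit interlacing function (defined through digits, see
`deinterlace_interlace`): digit number `a` of the coordinate `r` is digit number `a * d + r`
of the argument. -/
noncomputable def deinterlace (b d : ℕ) [NeZero b] (x : ℝ) (r : Fin d) : ℝ :=
  Real.ofDigits fun a : ℕ => Real.digits x b (a * d + r)

theorem ofDigits_lt_one {b : ℕ} (a : ℕ → Fin b) (i : ℕ) (hi : (a i : ℕ) + 1 ≠ b) :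
    Real.ofDigits a < 1 := by
  have hb0 : 0 < b := Fin.pos (a 0)
  have hb : 1 < b := by have := (a i).isLt; omega
  rw [← Real.ofDigits_const_last_eq_one' hb]
  refine Summable.tsum_lt_tsum (i := i) (fun n => ?_) ?_
    Real.summable_ofDigitsTerm Real.summable_ofDigitsTerm
  · unfold Real.ofDigitsTerm
    have h : ((a n : ℕ) : ℝ) ≤ ((b - 1 : ℕ) : ℝ) := by
      have := (a n).isLt
      exact_mod_cast (by omega : (a n : ℕ) ≤ b - 1)
    exact mul_le_mul_of_nonneg_right h (by positivity)
  · unfold Real.ofDigitsTerm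
    have h : ((a i : ℕ) : ℝ) < ((b - 1 : ℕ) : ℝ) := by
      have := (a i).isLt
      exact_mod_cast (by omega : (a i : ℕ) < b - 1)
    exact mul_lt_mul_of_pos_right h (by positivity)

theorem exists_nat_sum {b : ℕ} (hb : 0 < b) (a : ℕ → Fin b) (n : ℕ) :
    ∃ S : ℕ, (b : ℝ) ^ n * ∑ i ∈ Finset.range n, Real.ofDigitsTerm a i = S := by
  have hb' : (b : ℝ) ≠ 0 := by positivity
  induction n with
  | zero => exact ⟨0, by simp⟩
  | succ n ih =>
    obtain ⟨S, hS⟩ := ih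
    refine ⟨b * S + a n, ?_⟩
    rw [Finset.sum_range_succ, mul_add, pow_succ', mul_assoc, hS, Real.ofDigitsTerm, ← pow_succ']
    push_cast
    field_simp

theorem digits_ofDigits {b : ℕ} [NeZero b] (a : ℕ → Fin b)
    (ha : ∀ N, ∃ i, N ≤ i ∧ (a i : ℕ) + 1 ≠ b) : Real.digits (Real.ofDigits a) b = a := by
  have hb0 : 0 < b := NeZero.pos b
  have hb' : (b : ℝ) ≠ 0 := by positivity
  funext n
  obtain ⟨S, hS⟩ := exists_nat_sum hb0 a n
  have h : Real.ofDigits a * (b : ℝ) ^ (n + 1)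
      = ((b * S + a n : ℕ) : ℝ) + Real.ofDigits (fun i => a (i + (n + 1))) := by
    rw [Real.ofDigits_eq_sum_add_ofDigits a (n + 1), Finset.sum_range_succ, Real.ofDigitsTerm]
    push_cast
    rw [← hS]
    field_simp
    ring
  have h1 : Real.ofDigits (fun i => a (i + (n + 1))) < 1 := by
    obtain ⟨i, hi, hai⟩ := ha (n + 1)
    refine ofDigits_lt_one _ (i - (n + 1)) ?_
    rwa [Nat.sub_add_cancel hi]
  have h2 : ⌊Real.ofDigits a * (b : ℝ) ^ (n + 1)⌋₊ = b * S + a n := by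
    rw [h, Nat.floor_eq_iff (add_nonneg (Nat.cast_nonneg _) (Real.ofDigits_nonneg _))]
    exact ⟨by linarith [Real.ofDigits_nonneg (fun i => a (i + (n + 1)))], by linarith⟩
  ext
  rw [Real.digits, h2, Fin.val_ofNat, Nat.mul_add_mod, Nat.mod_eq_of_lt (a n).isLt]

theorem exists_digit_ne {b : ℕ} [NeZero b] (hb : 1 < b) {x : ℝ} (hx : x ∈ Set.Ico (0 : ℝ) 1)
    (N : ℕ) : ∃ i, N ≤ i ∧ (Real.digits x b i : ℕ) + 1 ≠ b := by
  by_contra! hcon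
  have h0 : (0 : ℝ) < (b : ℝ) ^ N := by positivity
  have htail : (fun i => Real.digits x b (i + N)) =
      fun _ => (⟨b - 1, Nat.sub_one_lt_of_lt hb⟩ : Fin b) := by
    funext i
    ext
    have := hcon (i + N) (Nat.le_add_left _ _)
    simp only
    omega
  have h := Real.ofDigits_eq_sum_add_ofDigits (Real.digits x b) N
  rw [Real.ofDigits_digits hb hx, htail, Real.ofDigits_const_last_eq_one' hb, mul_one] at h
  have h3 := Real.ofDigits_digits_sum_eq (b := b) hx N
  have h4 : (b : ℝ) ^ N * x = ⌊(b : ℝ) ^ N * x⌋₊ + 1 := by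
    rw [← h3]
    conv_lhs => rw [h]
    rw [mul_add, mul_inv_cancel₀ h0.ne']
  have h5 := Nat.lt_floor_add_one ((b : ℝ) ^ N * x)
  linarith

/-- On the range of the digit interlacing function, `deinterlace` is its inverse. -/
theorem deinterlace_interlace {b d : ℕ} [NeZero b] [NeZero d] (hb : 1 < b) (x : Fin d → ℝ)
    (hx : ∀ r, x r ∈ Set.Ico (0 : ℝ) 1) : deinterlace b d (interlace b d x) = x := by
  have hd : 0 < d := NeZero.pos d
  have key : ∀ (a : ℕ) (r : Fin d),
      Fin.ofNat d (a * d + r) = r ∧ (a * d + r) / d = a := by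
    intro a r
    constructor
    · ext
      rw [Fin.val_ofNat, mul_comm, Nat.mul_add_mod, Nat.mod_eq_of_lt r.isLt]
    · rw [mul_comm, Nat.mul_add_div hd, Nat.div_eq_of_lt r.isLt, add_zero]
  funext r
  unfold deinterlace interlace
  rw [digits_ofDigits]
  · simp only [(key _ r).1, (key _ r).2]
    exact Real.ofDigits_digits hb (hx r)
  · intro N
    obtain ⟨i, hi, h⟩ := exists_digit_ne hb (hx r) N
    refine ⟨i * d + r, ?_, ?_⟩
    · nlinarith
    · rw [(key i r).1, (key i r).2]
      exact h

end Digits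

/-- The digit interlacing function on nonnegative integers,
`∑ a, ∑ r, κ_{r,a} * b ^ (r + a * d)` with `κ_{r,a}` the base `b` digits of `k r`. -/
def interlaceNat (b : ℕ) {d : ℕ} (k : Fin d → ℕ) : ℕ :=
  ∑ r : Fin d, ∑ a ∈ Finset.range (Nat.digits b (k r)).length,
    (k r / b ^ a % b) * b ^ ((r : ℕ) + a * d)

/-- The `k`-th Walsh function in base `b`. -/
noncomputable def walsh (b : ℕ) [NeZero b] (k : ℕ) (x : ℝ) : ℂ :=
  Complex.exp (2 * Real.pi * Complex.I / b) ^
    (∑ j ∈ Finset.range (Nat.digits b k).length, (k / b ^ j % b) * (Real.digits x b j : ℕ))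

/-- The multivariate Walsh function, a product of one-dimensional ones. -/
noncomputable def walshProd (b : ℕ) [NeZero b] {n : ℕ} (k : Fin n → ℕ) (x : Fin n → ℝ) : ℂ :=
  ∏ i, walsh b (k i) (x i)

/-- The Walsh coefficient `∫ f(x) * conj (wal_k(x)) dx` over the unit cube. -/
noncomputable def walshCoeff (b : ℕ) [NeZero b] {s : ℕ} (f : (Fin s → ℝ) → ℝ)
    (k : Fin s → ℕ) : ℂ :=
  ∫ x in Set.Icc (0 : Fin s → ℝ) 1, (f x : ℂ) * (starRingEnd ℂ) (walshProd b k x)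

/-- The block of all `k` with `⌊b ^ (l - 1)⌋ ≤ k < b ^ l` in each coordinate
(`b ^ l / b` is a floor division, equal to `0` for `l = 0`). -/
def block (b : ℕ) {s d : ℕ} (l : Fin s → Fin d → ℕ) : Finset (Fin s → Fin d → ℕ) :=
  Fintype.piFinset fun i => Fintype.piFinset fun r =>
    Finset.Ico (b ^ l i r / b) (b ^ l i r)

/-- The sum of the squared moduli of the Walsh coefficients of `f` over the block of `l`. -/
noncomputable def sigmaSq (b : ℕ) [NeZero b] {s d : ℕ} (f : (Fin s → ℝ) → ℝ)
    (l : Fin s → Fin d → ℕ) : ℝ :=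
  ∑ k ∈ block b l, ‖walshCoeff b f fun i => interlaceNat b (k i)‖ ^ 2

/-- The points of the digital net over `ℤ/b` with generating matrices `C 0, …, C (s - 1)`. -/
noncomputable def digitalNet {b m s R : ℕ} (C : Fin s → Matrix (Fin R) (Fin m) (ZMod b))
    (n : Fin (b ^ m)) (i : Fin s) : ℝ :=
  ∑ j : Fin R,
    (((C i).mulVec fun q : Fin m => (((n : ℕ) / b ^ (q : ℕ) % b : ℕ) : ZMod b)) j).val
      / (b : ℝ) ^ ((j : ℕ) + 1)

/-- Owen's scrambling of one number `x ∈ [0,1)`: the digit number `k` is permuted by the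
permutation attached to the list of the preceding digits of `x`. -/
noncomputable def scramble {b : ℕ} [NeZero b] (σ : List (Fin b) → Equiv.Perm (Fin b)) (x : ℝ) : ℝ :=
  Real.ofDigits fun k : ℕ =>
    σ ((List.range k).map (Real.digits x b)) (Real.digits x b k)

/-- Owen's scrambling of a point of `[0,1)^d`, with one family of permutations per coordinate. -/
noncomputable def scramblePoint {b : ℕ} [NeZero b] {d : ℕ}
    (σ : Fin d → List (Fin b) → Equiv.Perm (Fin b)) (z : Fin d → ℝ) : Fin d → ℝ :=
  fun r => scramble (σ r) (z r)

/-- Owen's scrambling of order `d` of a point of `[0,1)^s`: undo the digit interlacing,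
scramble the resulting `d * s` coordinates, interlace the digits again. -/
noncomputable def scrambleOrder {b d s : ℕ} [NeZero b] [NeZero d]
    (σ : Fin s → Fin d → List (Fin b) → Equiv.Perm (Fin b)) (x : Fin s → ℝ) : Fin s → ℝ :=
  fun i => interlace b d (scramblePoint (σ i) (deinterlace b d (x i)))

/-- The random permutations of Owen's scrambling of `d * s` coordinates: mutually independent and
uniformly distributed, one for each coordinate and each list of preceding digits. -/
structure IsUniformScrambling {Ω : Type*} [MeasurableSpace Ω] (P : Measure Ω) {b d s : ℕ}
    (π : Fin s → Fin d → List (Fin b) → Ω → Equiv.Perm (Fin b)) : Prop where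
  measurableSet_eq : ∀ i r w τ, MeasurableSet {ω | π i r w ω = τ}
  uniform : ∀ i r w τ, P {ω | π i r w ω = τ} = ((Nat.factorial b : ℕ) : ENNReal)⁻¹
  indep : iIndepFun (m := fun _ => ⊤)
    (fun q : Fin s × Fin d × List (Fin b) => π q.1 q.2.1 q.2.2) P

/-- The estimator `b ^ (-m) * ∑ n, f (y_n)`, where `y_n` is the point `x_n` after Owen's scrambling
of order `d`, the same permutations being used for all points. -/
noncomputable def estimator {Ω : Type*} {b d s N : ℕ} [NeZero b] [NeZero d]
    (π : Fin s → Fin d → List (Fin b) → Ω → Equiv.Perm (Fin b))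
    (x : Fin N → Fin s → ℝ) (f : (Fin s → ℝ) → ℝ) (ω : Ω) : ℝ :=
  (1 / (N : ℝ)) * ∑ n, f (scrambleOrder (fun i r w => π i r w ω) (x n))

/-- The gain coefficient of order `d` of the points `x`, computed with the representative `k`
of a block. -/
noncomputable def gain {Ω : Type*} [MeasurableSpace Ω] (P : Measure Ω) {b d s N : ℕ} [NeZero b]
    (π : Fin s → Fin d → List (Fin b) → Ω → Equiv.Perm (Fin b))
    (x : Fin N → Fin s → ℝ) (k : Fin s → Fin d → ℕ) : ℂ :=
  (1 / (N : ℂ) ^ 2) * ∑ n, ∑ n', ∏ i, ∫ ω,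
    walshProd b (k i) (scramblePoint (fun r w => π i r w ω) (deinterlace b d (x n i))) *
      (starRingEnd ℂ)
        (walshProd b (k i) (scramblePoint (fun r w => π i r w ω) (deinterlace b d (x n' i)))) ∂P

end OwenNet

/-! The argument is carried out on the compact group of digit sequences of `d * s` coordinates with
its uniform product measure. There `cubePoint` interlaces digits and transports this measure to
Lebesgue measure on the cube (`measurePreserving_cubePoint`). The Walsh functions with interlaced
index pull back, almost everywhere, to the characters `digitWalsh k` (`walshProd_cubePoint`). By
Stone-Weierstrass and orthogonality these characters form a Hilbert basis of `L²`.

Scrambling any fixed point yields i.i.d. uniform digits (`IsUniformScrambling.map_scrambledDigits`).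
So each pair of points gives two isometries `F ↦ F ∘ Z`, `F ↦ F ∘ Z'` from this `L²` into `L²(P)`.
The sesquilinear form they define is diagonal in the Walsh basis: permutations at different digit
positions are independent, so a correlation of two characters is a product of `digitCorrelation`s,
and a factor vanishes wherever the two indices have different digits. `hasSum_inner_of_diagonal`
then writes `E[f(y_n) f(y_n')]` as a sum over `k` of the squared Walsh coefficient times the
correlation of the `k`-th character.

Averaging over `n` and `n'` turns the correlations into gain coefficients. These are constant on
blocks (`gain_eq_of_mem_block`), since in each coordinate only the position of the leading digit of
`k` matters. Grouping by blocks and removing the block of `0`, which contributes the squared mean,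
leaves the variance. -/

namespace OwenNet

/-! ### Base `b` digits of natural numbers and of interlaced indices -/

section NatDigits

variable {b : ℕ}

theorem sum_digits_lt_pow (c : ℕ → ℕ) (hc : ∀ j, c j < b) (L : ℕ) :
    ∑ j ∈ Finset.range L, c j * b ^ j < b ^ L := by
  induction L with
  | zero => simp
  | succ L ih =>
    rw [Finset.sum_range_succ, pow_succ]
    nlinarith [hc L, Nat.mul_le_mul_right (b ^ L) (Nat.succ_le_of_lt (hc L))]

theorem sum_digits_div_mod (c : ℕ → ℕ) (hc : ∀ j, c j < b) (L n : ℕ) :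
    (∑ j ∈ Finset.range L, c j * b ^ j) / b ^ n % b = if n < L then c n else 0 := by
  have hb : 0 < b := (Nat.zero_le _).trans_lt (hc 0)
  split_ifs with h
  · obtain ⟨p, rfl⟩ := Nat.exists_eq_add_of_lt h
    rw [add_assoc, Finset.sum_range_add]
    have h1 : ∑ x ∈ Finset.range (p + 1), c (n + x) * b ^ (n + x) =
        b ^ n * (c n + b * ∑ x ∈ Finset.range p, c (n + (x + 1)) * b ^ x) := by
      rw [Finset.sum_range_succ', add_comm, mul_add, Finset.mul_sum, Finset.mul_sum]
      congr 1
      · simp [mul_comm]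
      · exact Finset.sum_congr rfl fun x _ => by ring
    rw [h1, Nat.add_mul_div_left _ _ (by positivity), Nat.div_eq_of_lt (sum_digits_lt_pow c hc n),
      zero_add, Nat.add_mul_mod_self_left, Nat.mod_eq_of_lt (hc n)]
  · rw [Nat.div_eq_of_lt, Nat.zero_mod]
    exact (sum_digits_lt_pow c hc L).trans_le (Nat.pow_le_pow_right hb (not_lt.1 h))

theorem sum_digits_eq_self {k L : ℕ} (h : k < b ^ L) :
    ∑ j ∈ Finset.range L, (k / b ^ j % b) * b ^ j = k := by
  induction L generalizing k with
  | zero => simp at h; simp [h]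
  | succ L ih =>
    rw [Finset.sum_range_succ']
    have h1 : k / b < b ^ L := Nat.div_lt_of_lt_mul (by rwa [pow_succ'] at h)
    have h2 := ih h1
    have h3 : ∑ j ∈ Finset.range L, k / b ^ (j + 1) % b * b ^ (j + 1) = b * (k / b) := by
      conv_rhs => rw [← h2]
      rw [Finset.mul_sum]
      refine Finset.sum_congr rfl fun j _ => ?_
      rw [pow_succ', Nat.div_div_eq_div_mul]
      ring
    rw [h3]
    simp [Nat.div_add_mod]

theorem eq_of_div_mod_eq (hb : 1 < b) {k k' : ℕ} (h : ∀ j, k / b ^ j % b = k' / b ^ j % b) :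
    k = k' := by
  have h1 : k < b ^ (k + k') :=
    Nat.lt_pow_self hb |>.trans_le (Nat.pow_le_pow_right (by omega) (by omega))
  have h2 : k' < b ^ (k + k') :=
    Nat.lt_pow_self hb |>.trans_le (Nat.pow_le_pow_right (by omega) (by omega))
  calc k = _ := (sum_digits_eq_self h1).symm
    _ = _ := Finset.sum_congr rfl fun j _ => by rw [h j]
    _ = k' := sum_digits_eq_self h2

theorem div_pow_mod_eq_zero (hb : 1 < b) {k L j : ℕ} (h : k < b ^ L) (hj : L ≤ j) :
    k / b ^ j % b = 0 := by
  rw [Nat.div_eq_of_lt (h.trans_le (Nat.pow_le_pow_right (by omega) hj)), Nat.zero_mod]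

theorem sum_range_mul_add {M : Type*} [AddCommMonoid M] (d L : ℕ) (g : ℕ → M) :
    ∑ n ∈ Finset.range (L * d), g n =
      ∑ r : Fin d, ∑ a ∈ Finset.range L, g ((r : ℕ) + a * d) := by
  rw [Finset.sum_comm]
  induction L with
  | zero => simp
  | succ L ih =>
    rw [Nat.succ_mul, Finset.sum_range_add, ih, Finset.sum_range_succ, Finset.sum_range (n := d)]
    simp [add_comm]

/-- Digit sums may be extended beyond the length of the expansion. -/
theorem sum_digits_length_eq {M : Type*} [AddCommMonoid M] (hb : 1 < b) {k L : ℕ} (h : k < b ^ L)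
    (g : ℕ → ℕ → M) (hg : ∀ j, g 0 j = 0) :
    ∑ j ∈ Finset.range (Nat.digits b k).length, g (k / b ^ j % b) j =
      ∑ j ∈ Finset.range L, g (k / b ^ j % b) j := by
  refine Finset.sum_subset (Finset.range_mono ?_) fun j _ hj => ?_
  · rwa [Nat.digits_length_le_iff hb]
  · rw [div_pow_mod_eq_zero hb (Nat.lt_base_pow_length_digits hb) (by simpa using hj), hg]

theorem interlaceNat_eq (hb : 1 < b) {d : ℕ} [NeZero d] (k : Fin d → ℕ) {L : ℕ}
    (h : ∀ r, k r < b ^ L) :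
    interlaceNat b k =
      ∑ n ∈ Finset.range (L * d), (k (Fin.ofNat d n) / b ^ (n / d) % b) * b ^ n := by
  rw [sum_range_mul_add, interlaceNat]
  refine Finset.sum_congr rfl fun r _ => ?_
  rw [sum_digits_length_eq hb (h r) (fun c a => c * b ^ ((r : ℕ) + a * d)) (by simp)]
  refine Finset.sum_congr rfl fun a _ => ?_
  have h1 : Fin.ofNat d ((r : ℕ) + a * d) = r := by
    ext; rw [Fin.val_ofNat, Nat.add_mul_mod_self_right, Nat.mod_eq_of_lt r.isLt]
  have h2 : ((r : ℕ) + a * d) / d = a := by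
    rw [Nat.add_mul_div_right _ _ (NeZero.pos d), Nat.div_eq_of_lt r.isLt, zero_add]
  rw [h1, h2]

theorem interlaceNat_lt (hb : 1 < b) {d : ℕ} [NeZero d] (k : Fin d → ℕ) {L : ℕ}
    (h : ∀ r, k r < b ^ L) : interlaceNat b k < b ^ (L * d) := by
  rw [interlaceNat_eq hb k h]
  exact sum_digits_lt_pow _ (fun _ => Nat.mod_lt _ (by omega)) _

theorem interlaceNat_div_mod (hb : 1 < b) {d : ℕ} [NeZero d] (k : Fin d → ℕ) (n : ℕ) :
    interlaceNat b k / b ^ n % b = k (Fin.ofNat d n) / b ^ (n / d) % b := by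
  have h : ∀ r, k r < b ^ (∑ r, k r) := fun r =>
    Nat.lt_pow_self hb |>.trans_le (Nat.pow_le_pow_right (by omega)
      (Finset.single_le_sum (fun _ _ => Nat.zero_le _) (Finset.mem_univ r)))
  rw [interlaceNat_eq hb k h, sum_digits_div_mod (fun n => k (Fin.ofNat d n) / b ^ (n / d) % b)
    (fun _ => Nat.mod_lt _ (by omega))]
  split_ifs with hn
  · rfl
  · rw [div_pow_mod_eq_zero hb (h _)]
    rw [Nat.le_div_iff_mul_le (NeZero.pos d)]
    exact not_lt.1 hn

end NatDigits

/-! ### Digits of a uniform random number -/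

section DigitLaw

/-- The uniform distribution on the digits `0, …, b - 1`. -/
noncomputable def digitMeasure (b : ℕ) : Measure (Fin b) := (b : ENNReal)⁻¹ • Measure.count

instance (b : ℕ) [NeZero b] : IsProbabilityMeasure (digitMeasure b) where
  measure_univ := by
    rw [digitMeasure, Measure.smul_apply, Measure.count_univ]
    simp [ENNReal.inv_mul_cancel, NeZero.ne b]

variable {b : ℕ} [NeZero b]

theorem measurable_digits (n : ℕ) : Measurable fun x : ℝ => Real.digits x b n := by
  unfold Real.digits
  exact (measurable_from_top (f := fun n : ℕ => Fin.ofNat b n)).comp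
    (Nat.measurable_floor.comp (measurable_id.mul_const _))

/-- The hypotheses say `x = (c + u) / b` with `u ∈ [0,1)`: the first digit is split off and `u`
carries the remaining ones. -/
theorem digits_zero_eq {u : ℝ} (c : Fin b) (hu : u ∈ Set.Ico (0 : ℝ) 1) {x : ℝ}
    (hx : b * x - c = u) : Real.digits x b 0 = c := by
  have h : ⌊x * (b : ℝ) ^ (0 + 1)⌋₊ = (c : ℕ) := by
    rw [Nat.floor_eq_iff (by rw [zero_add, pow_one]; linarith [hu.1, Nat.cast_nonneg (α := ℝ) (c : ℕ)])]
    constructor <;> rw [zero_add, pow_one] <;> linarith [hu.1, hu.2]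
  ext
  rw [Real.digits, h, Fin.val_ofNat, Nat.mod_eq_of_lt c.isLt]

theorem digits_succ_eq {u : ℝ} (c : Fin b) (hu : u ∈ Set.Ico (0 : ℝ) 1) {x : ℝ}
    (hx : b * x - c = u) (n : ℕ) : Real.digits x b (n + 1) = Real.digits u b n := by
  have h : ⌊x * (b : ℝ) ^ (n + 1 + 1)⌋₊ = ⌊u * (b : ℝ) ^ (n + 1)⌋₊ + b * (c * b ^ n) := by
    rw [← Nat.floor_add_natCast (mul_nonneg hu.1 (by positivity)), ← hx]
    congr 1
    push_cast
    ring
  ext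
  rw [Real.digits, Real.digits, h, Fin.val_ofNat, Fin.val_ofNat, Nat.add_mul_mod_self_left]

/-- The map `x ↦ b * x - c` sends the numbers with first digit `c` onto `[0,1)` and shifts their
digits. This is the induction step for `volume_setOf_digits`. -/
theorem setOf_digits_succ (n : ℕ) (t : ℕ → Set (Fin b)) :
    {x : ℝ | x ∈ Set.Ico (0 : ℝ) 1 ∧ ∀ i < n + 1, Real.digits x b i ∈ t i} =
      ⋃ c ∈ (t 0).toFinite.toFinset, (fun x : ℝ => b * x - c) ⁻¹'
        {x : ℝ | x ∈ Set.Ico (0 : ℝ) 1 ∧ ∀ i < n, Real.digits x b i ∈ t (i + 1)} := by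
  have hb : (0 : ℝ) < b := by have := NeZero.pos b; positivity
  ext x
  simp only [Set.mem_ofPred_eq, Set.mem_iUnion, Set.mem_preimage, Set.Finite.mem_toFinset,
    exists_prop]
  constructor
  · rintro ⟨hx, h⟩
    have h0 : 0 ≤ b * x := mul_nonneg hb.le hx.1
    have hlt : ⌊b * x⌋₊ < b := by
      rw [Nat.floor_lt h0]
      nlinarith [hx.2]
    have hu : b * x - ((⟨⌊b * x⌋₊, hlt⟩ : Fin b) : ℕ) ∈ Set.Ico (0 : ℝ) 1 :=
      ⟨by simpa using Nat.floor_le h0, by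
        have := Nat.lt_floor_add_one (b * x)
        simp only
        linarith⟩
    refine ⟨⟨⌊b * x⌋₊, hlt⟩, ?_, hu, fun i hi => ?_⟩
    · rw [← digits_zero_eq _ hu rfl]
      exact h 0 (Nat.succ_pos n)
    · rw [← digits_succ_eq _ hu rfl]
      exact h (i + 1) (Nat.succ_lt_succ hi)
  · rintro ⟨c, hc, hu, h⟩
    refine ⟨⟨?_, ?_⟩, fun i hi => ?_⟩
    · by_contra hx
      have : (0 : ℝ) ≤ (c : ℕ) := Nat.cast_nonneg _
      nlinarith [hu.1]
    · by_contra hx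
      have : ((c : ℕ) : ℝ) + 1 ≤ b := by exact_mod_cast c.isLt
      nlinarith [hu.2]
    · rcases i with _ | i
      · rwa [digits_zero_eq _ hu rfl]
      · rw [digits_succ_eq _ hu rfl]
        exact h i (Nat.lt_of_succ_lt_succ hi)

theorem measurableSet_setOf_digits (n : ℕ) (t : ℕ → Set (Fin b)) :
    MeasurableSet {x : ℝ | x ∈ Set.Ico (0 : ℝ) 1 ∧ ∀ i < n, Real.digits x b i ∈ t i} := by
  have h : {x : ℝ | x ∈ Set.Ico (0 : ℝ) 1 ∧ ∀ i < n, Real.digits x b i ∈ t i} =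
      Set.Ico (0 : ℝ) 1 ∩ ⋂ i, ⋂ (_ : i < n), (fun x : ℝ => Real.digits x b i) ⁻¹' t i := by
    ext x; simp
  rw [h]
  exact measurableSet_Ico.inter (MeasurableSet.iInter fun i => MeasurableSet.iInter fun _ =>
    measurable_digits i (Set.toFinite _).measurableSet)

/-- The pieces belonging to different first digits are disjoint, and each is a copy, scaled by `1 /
b`, of the set given by the shifted conditions. -/
theorem volume_setOf_digits (n : ℕ) (t : ℕ → Set (Fin b)) :
    volume {x : ℝ | x ∈ Set.Ico (0 : ℝ) 1 ∧ ∀ i < n, Real.digits x b i ∈ t i} =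
      ∏ i ∈ Finset.range n, digitMeasure b (t i) := by
  have hb : (0 : ℝ) < b := by have := NeZero.pos b; positivity
  induction n generalizing t with
  | zero =>
    have h : {x : ℝ | x ∈ Set.Ico (0 : ℝ) 1 ∧ ∀ i < 0, Real.digits x b i ∈ t i} =
        Set.Ico (0 : ℝ) 1 := by ext x; simp
    rw [h]; simp
  | succ n ih =>
    have hm (c : Fin b) : Measurable (fun x : ℝ => b * x - c) := by fun_prop
    rw [setOf_digits_succ, measure_biUnion_finset]
    · have hc (c : Fin b) : volume ((fun x : ℝ => b * x - c) ⁻¹'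
          {x : ℝ | x ∈ Set.Ico (0 : ℝ) 1 ∧ ∀ i < n, Real.digits x b i ∈ t (i + 1)}) =
          (b : ENNReal)⁻¹ * ∏ i ∈ Finset.range n, digitMeasure b (t (i + 1)) := by
        rw [← ih (fun i => t (i + 1))]
        have := Real.volume_preimage_mul_left hb.ne' ((fun x => x + -((c : ℕ) : ℝ)) ⁻¹'
          {x : ℝ | x ∈ Set.Ico (0 : ℝ) 1 ∧ ∀ i < n, Real.digits x b i ∈ t (i + 1)})
        rw [measure_preimage_add_right, ← Set.preimage_comp] at this
        rw [abs_of_pos (inv_pos.2 hb), ENNReal.ofReal_inv_of_pos hb, ENNReal.ofReal_natCast] at this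
        rw [← this]
        rfl
      simp_rw [hc]
      rw [Finset.prod_range_succ', Finset.sum_const, digitMeasure, Measure.smul_apply,
        Measure.count_apply (Set.toFinite _).measurableSet, (t 0).toFinite.encard_eq_coe_toFinset_card]
      simp [mul_comm, mul_assoc, mul_left_comm]
    · intro c _ c' _ hcc
      refine Set.disjoint_left.2 fun x hx hx' => hcc ?_
      rw [← digits_zero_eq c hx.1 rfl, ← digits_zero_eq c' hx'.1 rfl]
    · exact fun c _ => hm c (measurableSet_setOf_digits n _)

/-- The digits of a uniformly distributed number are independent and uniformly distributed. -/
theorem map_digits_volume (b : ℕ) [NeZero b] :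
    (volume.restrict (Set.Ico (0 : ℝ) 1)).map (fun x => Real.digits x b) =
      Measure.infinitePi fun _ : ℕ => digitMeasure b := by
  classical
  refine Measure.eq_infinitePi _ fun I t ht => ?_
  rw [Measure.map_apply (measurable_pi_lambda _ measurable_digits)
      (.pi (Finset.countable_toSet I) fun i _ => ht i)]
  rw [Measure.restrict_apply (measurable_pi_lambda _ measurable_digits
      (.pi (Finset.countable_toSet I) fun i _ => ht i))]
  -- Conditions on `I` are padded with `univ`, of mass one, to conditions on an initial segment of
  -- digits.
  set t' : ℕ → Set (Fin b) := fun i => if i ∈ I then t i else Set.univ with ht'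
  obtain ⟨n, hn⟩ := I.exists_nat_subset_range
  have h : (fun x : ℝ => Real.digits x b) ⁻¹' Set.pi I t ∩ Set.Ico 0 1 =
      {x : ℝ | x ∈ Set.Ico (0 : ℝ) 1 ∧ ∀ i < n, Real.digits x b i ∈ t' i} := by
    ext x
    simp only [Set.mem_inter_iff, Set.mem_preimage, Set.mem_pi, Set.mem_ofPred_eq, Finset.mem_coe]
    rw [and_comm]
    refine and_congr_right fun _ => ⟨fun h i _ => ?_, fun h i hi => ?_⟩
    · by_cases hi : i ∈ I <;> simp [ht', hi, h i]
    · have := h i (Finset.mem_range.1 (hn hi))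
      simpa [ht', hi] using this
  rw [h, volume_setOf_digits, ← Finset.prod_subset hn]
  · exact Finset.prod_congr rfl fun i hi => by simp [ht', hi]
  · intro i _ hi
    simp [ht', hi]

/-- The product measure is the image of Lebesgue measure under `Real.digits`, and every digit
sequence produced by that map has the property. -/
theorem ae_exists_digit_ne (hb : 1 < b) :
    ∀ᵐ a ∂(Measure.infinitePi fun _ : ℕ => digitMeasure b),
      ∀ N, ∃ i, N ≤ i ∧ (a i : ℕ) + 1 ≠ b := by
  rw [← map_digits_volume b, ae_map_iff (measurable_pi_lambda _ measurable_digits).aemeasurable]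
  · filter_upwards [ae_restrict_mem measurableSet_Ico] with x hx N
    exact exists_digit_ne hb hx N
  · simp only [Set.ofPred_forall, Set.ofPred_exists]
    refine MeasurableSet.iInter fun N => MeasurableSet.iUnion fun i => ?_
    refine measurableSet_setOfPred.2 (.and measurable_const ?_)
    exact (measurable_from_top (f := fun c : Fin b => (c : ℕ) + 1 ≠ b)).comp (measurable_pi_apply i)

theorem map_ofDigits (hb : 1 < b) :
    (Measure.infinitePi fun _ : ℕ => digitMeasure b).map Real.ofDigits =
      volume.restrict (Set.Icc (0 : ℝ) 1) := by
  rw [← map_digits_volume b, Measure.map_map Real.continuous_ofDigits.measurable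
    (measurable_pi_lambda _ measurable_digits), ← restrict_Ico_eq_restrict_Icc]
  conv_rhs => rw [← Measure.map_id (μ := volume.restrict (Set.Ico (0 : ℝ) 1))]
  refine Measure.map_congr ?_
  filter_upwards [ae_restrict_mem measurableSet_Ico] with x hx
  exact Real.ofDigits_digits hb hx

end DigitLaw

/-! ### Walsh functions as characters, and their density -/

section Characters

/-- The primitive `b`-th root of unity in the definition of the Walsh functions. -/
noncomputable def root (b : ℕ) : ℂ := Complex.exp (2 * Real.pi * Complex.I / b)

theorem isPrimitiveRoot_root (b : ℕ) [NeZero b] : IsPrimitiveRoot (root b) b :=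
  Complex.isPrimitiveRoot_exp b (NeZero.ne b)

theorem root_pow_mod (b : ℕ) [NeZero b] (n : ℕ) : root b ^ (n % b) = root b ^ n :=
  (pow_eq_pow_mod n (isPrimitiveRoot_root b).pow_eq_one).symm

theorem norm_root_pow (b : ℕ) [NeZero b] (n : ℕ) : ‖root b ^ n‖ = 1 := by
  rw [norm_pow, (isPrimitiveRoot_root b).norm'_eq_one (NeZero.ne b), one_pow]

theorem root_pow_mul_conj (b : ℕ) [NeZero b] (n : ℕ) :
    root b ^ n * (starRingEnd ℂ) (root b ^ n) = 1 := by
  rw [Complex.mul_conj', norm_root_pow]; simp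

theorem root_pow_sub (b : ℕ) [NeZero b] {n : ℕ} (h : n ≤ b) :
    root b ^ (b - n) = (starRingEnd ℂ) (root b ^ n) := by
  have h1 : root b ^ n * root b ^ (b - n) = 1 := by
    rw [← pow_add, Nat.add_sub_cancel' h, (isPrimitiveRoot_root b).pow_eq_one]
  exact mul_left_cancel₀ (left_ne_zero_of_mul_eq_one h1) (h1.trans (root_pow_mul_conj b n).symm)

/-- The base `b` digit with the index `t = (i, r, a)` of a vector of nonnegative integers. -/
def digit (b : ℕ) {s d : ℕ} (k : Fin s → Fin d → ℕ) (t : Fin s × Fin d × ℕ) : ℕ :=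
  k t.1 t.2.1 / b ^ t.2.2 % b

/-- The indices of the first `L` digits of each coordinate. -/
def box (s d L : ℕ) : Finset (Fin s × Fin d × ℕ) :=
  Finset.univ ×ˢ Finset.univ ×ˢ Finset.range L

theorem mem_box {s d L : ℕ} {t : Fin s × Fin d × ℕ} : t ∈ box s d L ↔ t.2.2 < L := by
  simp [box]

variable {b s d : ℕ}

theorem digit_lt [NeZero b] (k : Fin s → Fin d → ℕ) (t : Fin s × Fin d × ℕ) : digit b k t < b :=
  Nat.mod_lt _ (NeZero.pos b)

theorem digit_eq_zero (hb : 1 < b) {k : Fin s → Fin d → ℕ} {L : ℕ} (h : ∀ i r, k i r < b ^ L)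
    {t : Fin s × Fin d × ℕ} (ht : t ∉ box s d L) : digit b k t = 0 :=
  div_pow_mod_eq_zero hb (h _ _) (not_lt.1 fun h => ht (mem_box.2 h))

/-- A crude bound from `k < b ^ k`, giving one cutoff for all coordinates; it is the cutoff built
into `digitWalsh`. -/
theorem lt_pow_sum (hb : 1 < b) (k : Fin s → Fin d → ℕ) (i : Fin s) (r : Fin d) :
    k i r < b ^ (∑ i, ∑ r, k i r) :=
  (Nat.lt_pow_self hb).trans_le <| Nat.pow_le_pow_right (by omega) <|
    (Finset.single_le_sum (f := fun r => k i r) (fun _ _ => Nat.zero_le _)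
      (Finset.mem_univ r)).trans
    (Finset.single_le_sum (f := fun i => ∑ r, k i r) (fun _ _ => Nat.zero_le _)
      (Finset.mem_univ i))

theorem eq_of_digit_eq (hb : 1 < b) {k k' : Fin s → Fin d → ℕ}
    (h : ∀ t, digit b k t = digit b k' t) : k = k' := by
  funext i r
  exact eq_of_div_mod_eq hb fun j => h (i, r, j)

theorem exists_digit_eq (c : Fin s × Fin d × ℕ → ℕ) (hc : ∀ t, c t < b) (L : ℕ)
    (h : ∀ t ∉ box s d L, c t = 0) : ∃ k : Fin s → Fin d → ℕ, ∀ t, digit b k t = c t := by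
  refine ⟨fun i r => ∑ j ∈ Finset.range L, c (i, r, j) * b ^ j, fun t => ?_⟩
  rw [digit, sum_digits_div_mod (fun j => c (t.1, t.2.1, j)) (fun _ => hc _)]
  split_ifs with ht
  · rfl
  · exact (h t (mt mem_box.1 ht)).symm

/-- The Walsh function of index `k`, as a character of the group of digit sequences. -/
noncomputable def digitWalsh (k : Fin s → Fin d → ℕ) (x : Fin s × Fin d × ℕ → Fin b) : ℂ :=
  ∏ t ∈ box s d (∑ i, ∑ r, k i r), root b ^ (digit b k t * (x t : ℕ))

/-- Zero digits contribute the factor one, so the cutoff is immaterial and several characters can be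
written over a common index set. -/
theorem digitWalsh_eq (hb : 1 < b) {k : Fin s → Fin d → ℕ} {T : Finset (Fin s × Fin d × ℕ)}
    (h : ∀ t ∉ T, digit b k t = 0) (x : Fin s × Fin d × ℕ → Fin b) :
    digitWalsh k x = ∏ t ∈ T, root b ^ (digit b k t * (x t : ℕ)) := by
  classical
  have h1 (T' : Finset (Fin s × Fin d × ℕ)) (h' : ∀ t ∉ T', digit b k t = 0) :
      ∏ t ∈ T', root b ^ (digit b k t * (x t : ℕ)) =
        ∏ t ∈ T' ∪ T, root b ^ (digit b k t * (x t : ℕ)) :=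
    Finset.prod_subset Finset.subset_union_left fun t _ ht => by simp [h' t ht]
  have h2 (T' : Finset (Fin s × Fin d × ℕ)) :
      ∏ t ∈ T, root b ^ (digit b k t * (x t : ℕ)) =
        ∏ t ∈ T' ∪ T, root b ^ (digit b k t * (x t : ℕ)) :=
    Finset.prod_subset Finset.subset_union_right fun t _ ht => by simp [h t ht]
  rw [digitWalsh, h1 _ fun t ht => digit_eq_zero hb (lt_pow_sum hb k) ht, ← h2]

/-- The index of the product is the digitwise sum modulo `b`, without carries. -/
theorem exists_digitWalsh_mul [NeZero b] (hb : 1 < b) (k k' : Fin s → Fin d → ℕ) :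
    ∃ k'' : Fin s → Fin d → ℕ, ∀ x : Fin s × Fin d × ℕ → Fin b,
      digitWalsh k'' x = digitWalsh k x * digitWalsh k' x := by
  have h1 := fun t => digit_eq_zero (t := t) hb (fun i r => (lt_pow_sum hb k i r).trans_le
    (Nat.pow_le_pow_right (by omega) (Nat.le_add_right _ (∑ i, ∑ r, k' i r))))
  have h2 := fun t => digit_eq_zero (t := t) hb (fun i r => (lt_pow_sum hb k' i r).trans_le
    (Nat.pow_le_pow_right (by omega) (Nat.le_add_left _ (∑ i, ∑ r, k i r))))
  obtain ⟨k'', hk⟩ := exists_digit_eq (b := b) (fun t => (digit b k t + digit b k' t) % b)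
    (fun _ => Nat.mod_lt _ (NeZero.pos b)) _ (fun t ht => by rw [h1 t ht, h2 t ht, Nat.zero_mod])
  refine ⟨k'', fun x => ?_⟩
  rw [digitWalsh_eq hb h1, digitWalsh_eq hb h2, digitWalsh_eq hb
    (fun t ht => by rw [hk, h1 t ht, h2 t ht, Nat.zero_mod]), ← Finset.prod_mul_distrib]
  refine Finset.prod_congr rfl fun t _ => ?_
  rw [hk, pow_mul, root_pow_mod, ← pow_mul, add_mul, pow_add]

theorem exists_digitWalsh_conj [NeZero b] (hb : 1 < b) (k : Fin s → Fin d → ℕ) :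
    ∃ k' : Fin s → Fin d → ℕ, ∀ x : Fin s × Fin d × ℕ → Fin b,
      digitWalsh k' x = (starRingEnd ℂ) (digitWalsh k x) := by
  have h1 := fun t => digit_eq_zero (t := t) hb (lt_pow_sum hb k)
  -- The outer `% b` keeps a zero digit zero, since `b - 0 = b` is not a digit.
  obtain ⟨k', hk⟩ := exists_digit_eq (b := b) (fun t => (b - digit b k t) % b)
    (fun _ => Nat.mod_lt _ (NeZero.pos b)) _ (fun t ht => by rw [h1 t ht]; simp)
  refine ⟨k', fun x => ?_⟩
  rw [digitWalsh_eq hb h1, digitWalsh_eq hb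
    (fun t ht => by rw [hk, h1 t ht]; simp), map_prod]
  refine Finset.prod_congr rfl fun t _ => ?_
  rw [hk, pow_mul, root_pow_mod, root_pow_sub b (digit_lt k t).le, ← map_pow, ← pow_mul]

theorem digitWalsh_zero (x : Fin s × Fin d × ℕ → Fin b) :
    digitWalsh (0 : Fin s → Fin d → ℕ) x = 1 := by
  simp [digitWalsh, digit]

theorem exists_digitWalsh_ne [NeZero b] (hb : 1 < b) {x y : Fin s × Fin d × ℕ → Fin b} (h : x ≠ y) :
    ∃ k : Fin s → Fin d → ℕ, digitWalsh k x ≠ digitWalsh k y := by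
  classical
  obtain ⟨t, ht⟩ := Function.ne_iff.1 h
  obtain ⟨k, hk⟩ := exists_digit_eq (b := b) (fun t' => if t' = t then 1 else 0)
    (fun t' => by split_ifs <;> omega) (t.2.2 + 1) (fun t' ht' => by
      rw [if_neg]
      rintro rfl
      exact ht' (mem_box.2 (Nat.lt_succ_self _)))
  refine ⟨k, fun h' => ht ?_⟩
  have h1 : ∀ t' ∉ ({t} : Finset (Fin s × Fin d × ℕ)), digit b k t' = 0 := fun t' ht' => by
    rw [hk, if_neg (by simpa using ht')]
  rw [digitWalsh_eq hb h1, digitWalsh_eq hb h1] at h'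
  simp only [Finset.prod_singleton, hk, if_true, one_mul] at h'
  exact Fin.ext ((isPrimitiveRoot_root b).pow_inj (x t).isLt (y t).isLt h')

theorem norm_digitWalsh [NeZero b] (k : Fin s → Fin d → ℕ) (x : Fin s × Fin d × ℕ → Fin b) :
    ‖digitWalsh k x‖ = 1 := by
  rw [digitWalsh, norm_prod]
  exact Finset.prod_eq_one fun t _ => norm_root_pow b _

theorem continuous_digitWalsh (k : Fin s → Fin d → ℕ) :
    Continuous (digitWalsh (b := b) k) := by
  refine continuous_finsetProd _ fun t _ => ?_
  exact (continuous_of_discreteTopology (f := fun c : Fin b => root b ^ (digit b k t * (c : ℕ)))).comp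
    (continuous_apply t)

/-- `digitWalsh` as a bundled continuous map. -/
noncomputable def digitWalshMap (b : ℕ) (k : Fin s → Fin d → ℕ) :
    C(Fin s × Fin d × ℕ → Fin b, ℂ) := ⟨digitWalsh k, continuous_digitWalsh k⟩

open Submodule Algebra in
-- Stone-Weierstrass. The characters contain `1` and are closed under products and conjugation, so
-- their span is already the star subalgebra they generate; characters supported on a single digit
-- separate points.
theorem span_digitWalshMap_closure_eq_top [NeZero b] (hb : 1 < b) :
    (span ℂ (Set.range (digitWalshMap (s := s) (d := d) b))).topologicalClosure = ⊤ := by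
  let A : StarSubalgebra ℂ C(Fin s × Fin d × ℕ → Fin b, ℂ) :=
    { toSubalgebra := adjoin ℂ (Set.range (digitWalshMap b))
      star_mem' := by
        change adjoin ℂ (Set.range (digitWalshMap b)) ≤ star (adjoin ℂ (Set.range (digitWalshMap b)))
        refine adjoin_le ?_
        rintro - ⟨k, rfl⟩
        obtain ⟨k', hk'⟩ := exists_digitWalsh_conj hb k
        exact subset_adjoin ⟨k', ContinuousMap.ext hk'⟩ }
  have hA : Subalgebra.toSubmodule A.toSubalgebra = span ℂ (Set.range (digitWalshMap b)) := by
    apply adjoin_eq_span_of_subset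
    refine Set.Subset.trans ?_ Submodule.subset_span
    intro x hx
    refine Submonoid.closure_induction (fun _ => id) ⟨0, ContinuousMap.ext digitWalsh_zero⟩ ?_ hx
    rintro - - - - ⟨k, rfl⟩ ⟨k', rfl⟩
    obtain ⟨k'', hk⟩ := exists_digitWalsh_mul hb k k'
    exact ⟨k'', ContinuousMap.ext hk⟩
  have hsep : A.SeparatesPoints := by
    intro x y hxy
    obtain ⟨k, hk⟩ := exists_digitWalsh_ne hb hxy
    exact ⟨_, ⟨digitWalshMap b k, subset_adjoin ⟨k, rfl⟩, rfl⟩, hk⟩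
  rw [← hA]
  exact congr_arg (Subalgebra.toSubmodule <| StarSubalgebra.toSubalgebra ·)
    (ContinuousMap.starSubalgebra_topologicalClosure_eq_top_of_separatesPoints A hsep)

/-- `digitWalsh` as an element of `L²`. -/
noncomputable def digitWalshLp (μ : Measure (Fin s × Fin d × ℕ → Fin b)) [IsFiniteMeasure μ]
    (k : Fin s → Fin d → ℕ) : Lp ℂ 2 μ :=
  ContinuousMap.toLp (E := ℂ) 2 μ ℂ (digitWalshMap b k)

theorem coeFn_digitWalshLp (μ : Measure (Fin s × Fin d × ℕ → Fin b)) [IsFiniteMeasure μ]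
    (k : Fin s → Fin d → ℕ) : digitWalshLp μ k =ᵐ[μ] digitWalsh k :=
  ContinuousMap.coeFn_toLp μ (digitWalshMap b k)

theorem span_digitWalshLp_closure_eq_top [NeZero b] (hb : 1 < b)
    (μ : Measure (Fin s × Fin d × ℕ → Fin b)) [IsFiniteMeasure μ] :
    (Submodule.span ℂ (Set.range (digitWalshLp μ))).topologicalClosure = ⊤ := by
  have h := (ContinuousMap.toLp_denseRange ℂ μ ℂ
    (p := 2) (by norm_num)).topologicalClosure_map_submodule
      (span_digitWalshMap_closure_eq_top (s := s) (d := d) hb)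
  rw [Submodule.map_span, ← Set.range_comp] at h
  exact h

end Characters

/-! ### Character sums over the symmetric group -/

section PermSums

variable {b : ℕ}

/-- Left multiplication by a transposition matches the fibres of `τ ↦ τ a`, so these `b` fibres have
equal size. -/
theorem mul_card_perm_apply_eq (a c : Fin b) :
    b * (Finset.univ.filter fun τ : Equiv.Perm (Fin b) => τ a = c).card = Nat.factorial b := by
  have h : ∀ c' : Fin b, (Finset.univ.filter fun τ : Equiv.Perm (Fin b) => τ a = c').card =
      (Finset.univ.filter fun τ : Equiv.Perm (Fin b) => τ a = c).card := fun c' => by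
    refine Finset.card_equiv (Equiv.mulLeft (Equiv.swap c c')) fun τ => ?_
    simp only [Finset.mem_filter, Finset.mem_univ, true_and, Equiv.coe_mulLeft,
      Equiv.Perm.mul_apply]
    rw [Equiv.swap_apply_eq_iff, Equiv.swap_apply_left]
  have h1 := Finset.card_eq_sum_card_fiberwise (f := fun τ : Equiv.Perm (Fin b) => τ a)
    (s := Finset.univ) (t := Finset.univ) (fun _ _ => by simp)
  simp only [h] at h1
  rw [Finset.card_univ, Fintype.card_perm, Fintype.card_fin] at h1
  simp [h1]

variable [NeZero b]

theorem root_pow_mul_add_one (c : ℕ) (x : Fin b) :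
    root b ^ (c * ((x + 1 : Fin b) : ℕ)) = root b ^ c * root b ^ (c * (x : ℕ)) := by
  rw [Fin.val_add, mul_comm, pow_mul, root_pow_mod, ← pow_mul, ← pow_add]
  -- For `b = 1` the element `1 : Fin b` has value zero, but then the root of unity is one.
  rcases eq_or_ne b 1 with rfl | hb
  · have h : root 1 = 1 := by simp [root]
    simp [h]
  · have : ((1 : Fin b) : ℕ) = 1 := by
      rw [Fin.val_one']; exact Nat.mod_eq_of_lt (by have := NeZero.pos b; omega)
    rw [this]
    congr 1
    ring

theorem sum_root_pow_eq_zero {c : ℕ} (hc : c < b) (hc0 : c ≠ 0) :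
    ∑ x : Fin b, root b ^ (c * (x : ℕ)) = 0 := by
  have h : ∑ x : Fin b, root b ^ (c * (x : ℕ)) =
      root b ^ c * ∑ x : Fin b, root b ^ (c * (x : ℕ)) := by
    rw [Finset.mul_sum, ← Equiv.sum_comp (Equiv.addRight (1 : Fin b))]
    exact Finset.sum_congr rfl fun x _ => root_pow_mul_add_one c x
  have h1 : root b ^ c ≠ 1 := (isPrimitiveRoot_root b).pow_ne_one_of_pos_of_lt hc0 hc
  by_contra h0
  exact h1 (mul_right_cancel₀ h0 ((one_mul _).trans h)).symm

/-- Replacing `τ` by `τ + 1` permutes the summands and multiplies the sum by `root b ^ c ≠ 1`. -/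
theorem sum_perm_root_pow_eq_zero {c : ℕ} (hc : c < b) (hc0 : c ≠ 0) (a : Fin b) :
    ∑ τ : Equiv.Perm (Fin b), root b ^ (c * (τ a : ℕ)) = 0 := by
  have h : ∑ τ : Equiv.Perm (Fin b), root b ^ (c * (τ a : ℕ)) =
      root b ^ c * ∑ τ : Equiv.Perm (Fin b), root b ^ (c * (τ a : ℕ)) := by
    rw [Finset.mul_sum, ← Equiv.sum_comp (Equiv.mulLeft (Equiv.addRight (1 : Fin b)))]
    exact Finset.sum_congr rfl fun τ _ => root_pow_mul_add_one c (τ a)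
  have h1 : root b ^ c ≠ 1 := (isPrimitiveRoot_root b).pow_ne_one_of_pos_of_lt hc0 hc
  by_contra h0
  exact h1 (mul_right_cancel₀ h0 ((one_mul _).trans h)).symm

/-- The same translation multiplies the sum by `root b ^ c` times the conjugate of `root b ^ c'`,
which differs from one. This is the source of diagonality in the Walsh basis. -/
theorem sum_perm_root_pow_mul_conj_of_ne {c c' : ℕ} (hc : c < b) (hc' : c' < b) (h : c ≠ c')
    (a a' : Fin b) :
    ∑ τ : Equiv.Perm (Fin b), root b ^ (c * (τ a : ℕ)) *
      (starRingEnd ℂ) (root b ^ (c' * (τ a' : ℕ))) = 0 := by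
  have h1 : ∑ τ : Equiv.Perm (Fin b), root b ^ (c * (τ a : ℕ)) *
      (starRingEnd ℂ) (root b ^ (c' * (τ a' : ℕ))) =
      (root b ^ c * (starRingEnd ℂ) (root b ^ c')) *
      ∑ τ : Equiv.Perm (Fin b), root b ^ (c * (τ a : ℕ)) *
        (starRingEnd ℂ) (root b ^ (c' * (τ a' : ℕ))) := by
    rw [Finset.mul_sum, ← Equiv.sum_comp (Equiv.mulLeft (Equiv.addRight (1 : Fin b)))]
    refine Finset.sum_congr rfl fun τ _ => ?_
    change root b ^ (c * ((τ a + 1 : Fin b) : ℕ)) *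
      (starRingEnd ℂ) (root b ^ (c' * ((τ a' + 1 : Fin b) : ℕ))) = _
    rw [root_pow_mul_add_one, root_pow_mul_add_one, map_mul]
    ring
  by_contra h0
  have h2 := mul_right_cancel₀ h0 ((one_mul _).trans h1)
  refine h ((isPrimitiveRoot_root b).pow_inj hc hc' ?_)
  rw [← root_pow_mul_conj b c'] at h2
  refine (mul_right_cancel₀ ?_ h2).symm
  exact right_ne_zero_of_mul_eq_one (root_pow_mul_conj b c')

theorem sum_perm_root_pow_mul_conj_self (c : ℕ) (a : Fin b) :
    ∑ τ : Equiv.Perm (Fin b), root b ^ (c * (τ a : ℕ)) *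
      (starRingEnd ℂ) (root b ^ (c * (τ a : ℕ))) = (Nat.factorial b : ℂ) := by
  simp_rw [root_pow_mul_conj]
  simp [Fintype.card_perm]

/-- As the second digit runs over all values the sums `S x` add up to zero, because `c ≠ 0`. The
term at `a` is `b!`, and the other `b - 1` terms agree by right multiplication with a transposition
fixing `a`. The value does not depend on `c`, which makes the gain depend only on the block. -/
theorem sum_perm_root_pow_mul_conj_of_digit_ne {c : ℕ} (hc : c < b) (hc0 : c ≠ 0) {a a' : Fin b}
    (h : a ≠ a') :
    ((b : ℂ) - 1) * ∑ τ : Equiv.Perm (Fin b), root b ^ (c * (τ a : ℕ)) *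
      (starRingEnd ℂ) (root b ^ (c * (τ a' : ℕ))) = -(Nat.factorial b : ℂ) := by
  set S : Fin b → ℂ := fun a' => ∑ τ : Equiv.Perm (Fin b), root b ^ (c * (τ a : ℕ)) *
    (starRingEnd ℂ) (root b ^ (c * (τ a' : ℕ))) with hS
  have h1 : ∑ x, S x = 0 := by
    simp only [hS]
    rw [Finset.sum_comm]
    refine Finset.sum_eq_zero fun τ _ => ?_
    rw [← Finset.mul_sum, ← map_sum, Equiv.sum_comp τ (fun x : Fin b => root b ^ (c * (x : ℕ))),
      sum_root_pow_eq_zero hc hc0, map_zero, mul_zero]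
  have h2 : ∀ x ∈ Finset.univ.erase a, S x = S a' := fun x hx => by
    simp only [hS]
    rw [← Equiv.sum_comp (Equiv.mulRight (Equiv.swap a' x))]
    refine Finset.sum_congr rfl fun τ _ => ?_
    simp only [Equiv.coe_mulRight, Equiv.Perm.mul_apply, Equiv.swap_apply_right,
      Equiv.swap_apply_of_ne_of_ne h (Finset.ne_of_mem_erase hx).symm]
  rw [← Finset.add_sum_erase _ _ (Finset.mem_univ a), Finset.sum_congr rfl h2, Finset.sum_const,
    Finset.card_erase_of_mem (Finset.mem_univ a), Finset.card_univ, Fintype.card_fin, nsmul_eq_mul,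
    Nat.cast_sub (NeZero.pos b), Nat.cast_one,
    show S a = _ from sum_perm_root_pow_mul_conj_self c a] at h1
  exact eq_neg_of_add_eq_zero_right h1

end PermSums

/-! ### Independence of groups of variables -/

section GroupedIndependence

/-- Independence is preserved by grouping the random variables. -/
theorem iIndepFun_sigma_curry {Ω ι : Type*} {mΩ : MeasurableSpace Ω} {P : Measure Ω} {κ : ι → Type*}
    {E : (i : ι) → κ i → Type*} {mE : ∀ i j, MeasurableSpace (E i j)}
    {X : (p : Σ i, κ i) → Ω → E p.1 p.2} (mX : ∀ p, Measurable (X p)) (h : iIndepFun X P) :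
    iIndepFun (fun i ω j => X ⟨i, j⟩ ω) P := by
  have := h.isProbabilityMeasure
  have hP : ∀ i j, IsProbabilityMeasure (P.map (X ⟨i, j⟩)) :=
    fun i j => Measure.isProbabilityMeasure_map (mX _).aemeasurable
  rw [iIndepFun_iff_map_fun_eq_infinitePi_map
    fun i => measurable_pi_lambda _ fun j => mX ⟨i, j⟩]
  have h1 : (fun ω i j => X ⟨i, j⟩ ω) = (MeasurableEquiv.piCurry E) ∘ fun ω p => X p ω := rfl
  rw [h1, ← Measure.map_map (MeasurableEquiv.measurable _) (measurable_pi_lambda _ mX),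
    h.map_fun_eq_infinitePi_map mX]
  rw [Measure.infinitePi_map_piCurry (fun i j => P.map (X ⟨i, j⟩))]
  congr 1
  funext i
  exact ((h.precomp (g := fun j => (⟨i, j⟩ : Σ i, κ i))
    (fun j j' hj => by simpa using hj)).map_fun_eq_infinitePi_map (fun j => mX ⟨i, j⟩)).symm

end GroupedIndependence

/-! ### Law and correlations of scrambled digits -/

section Scrambling

variable {Ω : Type*} [MeasurableSpace Ω] {P : Measure Ω} {b d s : ℕ}
  {π : Fin s → Fin d → List (Fin b) → Ω → Equiv.Perm (Fin b)}

theorem IsUniformScrambling.measurable_comp (hπ : IsUniformScrambling P π) {E : Type*}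
    [MeasurableSpace E] (g : Equiv.Perm (Fin b) → E) (i : Fin s) (r : Fin d) (w : List (Fin b)) :
    Measurable fun ω => g (π i r w ω) := by
  let _ : MeasurableSpace (Equiv.Perm (Fin b)) := ⊤
  exact measurable_from_top.comp (measurable_to_countable' fun τ => hπ.measurableSet_eq i r w τ)

theorem IsUniformScrambling.integral_comp (hπ : IsUniformScrambling P π) [IsProbabilityMeasure P]
    (g : Equiv.Perm (Fin b) → ℂ) (i : Fin s) (r : Fin d) (w : List (Fin b)) :
    ∫ ω, g (π i r w ω) ∂P = (Nat.factorial b : ℂ)⁻¹ * ∑ τ, g τ := by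
  let _ : MeasurableSpace (Equiv.Perm (Fin b)) := ⊤
  have hm : Measurable (π i r w) := hπ.measurable_comp id i r w
  have := Measure.isProbabilityMeasure_map (μ := P) hm.aemeasurable
  rw [← integral_map (φ := π i r w) (f := g) hm.aemeasurable
    measurable_from_top.aestronglyMeasurable, integral_fintype .of_finite, Finset.mul_sum]
  refine Finset.sum_congr rfl fun τ _ => ?_
  rw [measureReal_def, Measure.map_apply hm (MeasurableSet.singleton τ)]
  have h : P (π i r w ⁻¹' {τ}) = _ := hπ.uniform i r w τ
  rw [h]
  simp [Algebra.smul_def]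

theorem IsUniformScrambling.integral_mul_of_ne (hπ : IsUniformScrambling P π)
    [IsProbabilityMeasure P] (g g' : Equiv.Perm (Fin b) → ℂ) (i : Fin s) (r : Fin d)
    {w w' : List (Fin b)} (h : w ≠ w') :
    ∫ ω, g (π i r w ω) * g' (π i r w' ω) ∂P =
      (∫ ω, g (π i r w ω) ∂P) * ∫ ω, g' (π i r w' ω) ∂P := by
  let _ : MeasurableSpace (Equiv.Perm (Fin b)) := ⊤
  have h1 : IndepFun (π i r w) (π i r w') P :=
    hπ.indep.indepFun (i := (i, r, w)) (j := (i, r, w')) (by simpa using h)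
  exact (h1.comp (φ := g) (ψ := g') measurable_from_top
    measurable_from_top).integral_fun_mul_eq_mul_integral
      (hπ.measurable_comp g i r w).aestronglyMeasurable
      (hπ.measurable_comp g' i r w').aestronglyMeasurable

/-- The length of a word records the digit position, so different `t` involve disjoint families of
permutations. Grouping the permutations by `t` makes the factors independent, although the two
permutations inside one factor may coincide. -/
theorem IsUniformScrambling.integral_prod (hπ : IsUniformScrambling P π)
    [IsProbabilityMeasure P] (T : Finset (Fin s × Fin d × ℕ))
    (w w' : Fin s × Fin d × ℕ → List (Fin b)) (hw : ∀ t, (w t).length = t.2.2)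
    (hw' : ∀ t, (w' t).length = t.2.2)
    (G : Fin s × Fin d × ℕ → Equiv.Perm (Fin b) → Equiv.Perm (Fin b) → ℂ) :
    ∫ ω, ∏ t ∈ T, G t (π t.1 t.2.1 (w t) ω) (π t.1 t.2.1 (w' t) ω) ∂P =
      ∏ t ∈ T, ∫ ω, G t (π t.1 t.2.1 (w t) ω) (π t.1 t.2.1 (w' t) ω) ∂P := by
  let _ : MeasurableSpace (Equiv.Perm (Fin b)) := ⊤
  have h1 : iIndepFun (fun (p : Σ t : T, {v : List (Fin b) // v.length = t.1.2.2}) =>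
      π p.1.1.1 p.1.1.2.1 p.2.1) P :=
    hπ.indep.precomp (g := fun p : Σ t : T, {v : List (Fin b) // v.length = t.1.2.2} =>
      (p.1.1.1, p.1.1.2.1, p.2.1)) (by
        rintro ⟨⟨⟨i, r, j⟩, ht⟩, ⟨v, hv⟩⟩ ⟨⟨⟨i', r', j'⟩, ht'⟩, ⟨v', hv'⟩⟩ h
        simp only [Prod.mk.injEq] at h hv hv'
        obtain ⟨rfl, rfl, rfl⟩ := h
        obtain rfl := hv.symm.trans hv'
        rfl)
  have h2 := iIndepFun_sigma_curry (ι := T)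
    (κ := fun t => {v : List (Fin b) // v.length = t.1.2.2}) (E := fun _ _ => Equiv.Perm (Fin b))
    (X := fun (p : Σ t : T, {v : List (Fin b) // v.length = t.1.2.2}) =>
      π p.1.1.1 p.1.1.2.1 p.2.1) (fun p => hπ.measurable_comp id _ _ _) h1
  have hd : DiscreteMeasurableSpace (Equiv.Perm (Fin b)) := ⟨fun _ => trivial⟩
  have hG : ∀ t, Measurable fun q : Equiv.Perm (Fin b) × Equiv.Perm (Fin b) => G t q.1 q.2 :=
    fun t => .of_discrete
  have h3 := h2.comp (fun t x => G t.1 (x ⟨w t, hw t⟩) (x ⟨w' t, hw' t⟩)) fun t =>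
    (hG t.1).comp (g := fun q : Equiv.Perm (Fin b) × Equiv.Perm (Fin b) => G t.1 q.1 q.2)
      (f := fun x : {v : List (Fin b) // v.length = t.1.2.2} → Equiv.Perm (Fin b) =>
        (x ⟨w t, hw t⟩, x ⟨w' t, hw' t⟩))
      ((measurable_pi_apply _).prodMk (measurable_pi_apply _))
  have h4 := h3.integral_fun_prod_eq_prod_integral fun t =>
    ((hG t.1).comp ((hπ.measurable_comp id t.1.1 t.1.2.1 (w t)).prodMk
      (hπ.measurable_comp id t.1.1 t.1.2.1 (w' t)))).aestronglyMeasurable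
  simp_rw [← Finset.prod_coe_sort T]
  exact h4

variable [NeZero b]

/-- The digits obtained by scrambling the coordinates of `u`. -/
noncomputable def scrambledDigits (π : Fin s → Fin d → List (Fin b) → Ω → Equiv.Perm (Fin b))
    (u : Fin s → Fin d → ℝ) (ω : Ω) (t : Fin s × Fin d × ℕ) : Fin b :=
  π t.1 t.2.1 ((List.range t.2.2).map (Real.digits (u t.1 t.2.1) b)) ω
    (Real.digits (u t.1 t.2.1) b t.2.2)

theorem IsUniformScrambling.measurable_scrambledDigits (hπ : IsUniformScrambling P π)
    (u : Fin s → Fin d → ℝ) : Measurable (scrambledDigits π u) :=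
  measurable_pi_lambda _ fun _ => hπ.measurable_comp (fun τ => τ _) _ _ _

/-- The law of a scrambled point. -/
theorem IsUniformScrambling.map_scrambledDigits (hπ : IsUniformScrambling P π)
    [IsProbabilityMeasure P] (u : Fin s → Fin d → ℝ) :
    P.map (scrambledDigits π u) =
      Measure.infinitePi fun _ : Fin s × Fin d × ℕ => digitMeasure b := by
  let _ : MeasurableSpace (Equiv.Perm (Fin b)) := ⊤
  have h1 : iIndepFun (fun t ω => scrambledDigits π u ω t) P := by
    -- Each digit uses its own permutation: the preceding words at different positions have
    -- different lengths.
    have h := hπ.indep.precomp (g := fun t : Fin s × Fin d × ℕ =>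
      (t.1, t.2.1, (List.range t.2.2).map (Real.digits (u t.1 t.2.1) b))) (by
        rintro ⟨i, r, j⟩ ⟨i', r', j'⟩ h
        simp only [Prod.mk.injEq] at h
        have := congrArg List.length h.2.2
        simp only [List.length_map, List.length_range] at this
        simp [h.1, h.2.1, this])
    exact h.comp (fun t τ => τ (Real.digits (u t.1 t.2.1) b t.2.2)) fun _ => measurable_from_top
  refine (h1.map_fun_eq_infinitePi_map fun t => (measurable_pi_apply t).comp
    (hπ.measurable_scrambledDigits u)).trans ?_
  congr 1
  funext t
  refine Measure.ext_of_singleton fun c => ?_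
  rw [Measure.map_apply ((measurable_pi_apply t).comp
    (hπ.measurable_scrambledDigits u)) (MeasurableSet.singleton c)]
  set a := Real.digits (u t.1 t.2.1) b t.2.2 with ha
  set w := (List.range t.2.2).map (Real.digits (u t.1 t.2.1) b) with hw
  have h2 : (fun f => f t) ∘ scrambledDigits π u ⁻¹' {c} =
      ⋃ τ ∈ Finset.univ.filter (fun τ : Equiv.Perm (Fin b) => τ a = c),
        {ω | π t.1 t.2.1 w ω = τ} := by
    ext ω
    simp [scrambledDigits, ha, hw]
  rw [h2, measure_biUnion_finset (fun τ _ τ' _ h => Set.disjoint_left.2 fun ω h1 h2 =>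
    h (h1.symm.trans h2)) fun τ _ => hπ.measurableSet_eq _ _ _ _]
  simp_rw [hπ.uniform]
  rw [Finset.sum_const, nsmul_eq_mul, ← mul_card_perm_apply_eq a c, digitMeasure,
    Measure.smul_apply, Measure.count_singleton, smul_eq_mul, mul_one, Nat.cast_mul,
    ENNReal.mul_inv (.inr (ENNReal.natCast_ne_top _)) (.inl (ENNReal.natCast_ne_top _)),
    mul_left_comm, ENNReal.mul_inv_cancel, mul_one]
  · rw [Nat.cast_ne_zero]
    intro h
    have := mul_card_perm_apply_eq a c
    rw [h, mul_zero] at this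
    exact Nat.factorial_ne_zero b this.symm
  · exact ENNReal.natCast_ne_top _

/-- The contribution of the digit with index `t` to the correlation of two Walsh functions with
digits `c`, `c'` at two scrambled points. -/
noncomputable def digitCorrelation (P : Measure Ω)
    (π : Fin s → Fin d → List (Fin b) → Ω → Equiv.Perm (Fin b))
    (u u' : Fin s → Fin d → ℝ) (t : Fin s × Fin d × ℕ) (c c' : ℕ) : ℂ :=
  ∫ ω, root b ^ (c * (scrambledDigits π u ω t : ℕ)) *
    (starRingEnd ℂ) (root b ^ (c' * (scrambledDigits π u' ω t : ℕ))) ∂P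

variable [IsProbabilityMeasure P] {u u' : Fin s → Fin d → ℝ} {t : Fin s × Fin d × ℕ}

theorem digitCorrelation_zero : digitCorrelation P π u u' t 0 0 = 1 := by
  simp [digitCorrelation]

/-- Different words select independent permutations, so the expectation factors, and a factor with
nonzero digit has mean zero. -/
theorem IsUniformScrambling.digitCorrelation_of_word_ne (hπ : IsUniformScrambling P π)
    (h : (List.range t.2.2).map (Real.digits (u t.1 t.2.1) b) ≠
      (List.range t.2.2).map (Real.digits (u' t.1 t.2.1) b)) {c c' : ℕ} (hc : c < b) (hc' : c' < b)
    (h0 : c ≠ 0 ∨ c' ≠ 0) : digitCorrelation P π u u' t c c' = 0 := by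
  unfold digitCorrelation scrambledDigits
  rw [hπ.integral_mul_of_ne
    (fun τ => root b ^ (c * (τ (Real.digits (u t.1 t.2.1) b t.2.2) : ℕ)))
    (fun τ => (starRingEnd ℂ) (root b ^ (c' * (τ (Real.digits (u' t.1 t.2.1) b t.2.2) : ℕ))))
    _ _ h]
  rcases h0 with h0 | h0
  · rw [hπ.integral_comp (fun τ => root b ^ (c * (τ (Real.digits (u t.1 t.2.1) b t.2.2) : ℕ))),
      sum_perm_root_pow_eq_zero hc h0, mul_zero, zero_mul]
  · rw [hπ.integral_comp (fun τ => (starRingEnd ℂ)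
        (root b ^ (c' * (τ (Real.digits (u' t.1 t.2.1) b t.2.2) : ℕ)))), ← map_sum,
      sum_perm_root_pow_eq_zero hc' h0, map_zero, mul_zero, mul_zero]

theorem IsUniformScrambling.digitCorrelation_of_word_eq (hπ : IsUniformScrambling P π)
    (h : (List.range t.2.2).map (Real.digits (u t.1 t.2.1) b) =
      (List.range t.2.2).map (Real.digits (u' t.1 t.2.1) b)) (c c' : ℕ) :
    digitCorrelation P π u u' t c c' = (Nat.factorial b : ℂ)⁻¹ *
      ∑ τ : Equiv.Perm (Fin b), root b ^ (c * (τ (Real.digits (u t.1 t.2.1) b t.2.2) : ℕ)) *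
        (starRingEnd ℂ) (root b ^ (c' * (τ (Real.digits (u' t.1 t.2.1) b t.2.2) : ℕ))) := by
  unfold digitCorrelation scrambledDigits
  rw [← h]
  exact hπ.integral_comp (fun τ =>
    root b ^ (c * (τ (Real.digits (u t.1 t.2.1) b t.2.2) : ℕ)) *
      (starRingEnd ℂ) (root b ^ (c' * (τ (Real.digits (u' t.1 t.2.1) b t.2.2) : ℕ)))) _ _ _

theorem IsUniformScrambling.digitCorrelation_of_ne (hπ : IsUniformScrambling P π) {c c' : ℕ}
    (hc : c < b) (hc' : c' < b) (h : c ≠ c') : digitCorrelation P π u u' t c c' = 0 := by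
  by_cases hw : (List.range t.2.2).map (Real.digits (u t.1 t.2.1) b) =
      (List.range t.2.2).map (Real.digits (u' t.1 t.2.1) b)
  · rw [hπ.digitCorrelation_of_word_eq hw, sum_perm_root_pow_mul_conj_of_ne hc hc' h, mul_zero]
  · exact hπ.digitCorrelation_of_word_ne hw hc hc' (by omega)

theorem IsUniformScrambling.digitCorrelation_of_digits_eq (hπ : IsUniformScrambling P π)
    (h : ∀ j ≤ t.2.2, Real.digits (u t.1 t.2.1) b j = Real.digits (u' t.1 t.2.1) b j) (c : ℕ) :
    digitCorrelation P π u u' t c c = 1 := by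
  rw [hπ.digitCorrelation_of_word_eq (List.map_congr_left fun j hj =>
    h j (List.mem_range.1 hj).le), h _ le_rfl, sum_perm_root_pow_mul_conj_self,
    inv_mul_cancel₀ (Nat.cast_ne_zero.2 (Nat.factorial_ne_zero b))]

/-- With different words both sides are `0`; with equal words they are `1` or `-1 / (b - 1)`
according to whether the current digits agree. -/
theorem IsUniformScrambling.digitCorrelation_eq_of_ne_zero (hπ : IsUniformScrambling P π)
    (hb : 1 < b) {c c' : ℕ} (hc : c < b) (hc' : c' < b) (h0 : c ≠ 0) (h0' : c' ≠ 0) :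
    digitCorrelation P π u u' t c c = digitCorrelation P π u u' t c' c' := by
  by_cases hw : (List.range t.2.2).map (Real.digits (u t.1 t.2.1) b) =
      (List.range t.2.2).map (Real.digits (u' t.1 t.2.1) b)
  · rw [hπ.digitCorrelation_of_word_eq hw, hπ.digitCorrelation_of_word_eq hw]
    congr 1
    by_cases ha : Real.digits (u t.1 t.2.1) b t.2.2 = Real.digits (u' t.1 t.2.1) b t.2.2
    · rw [ha, sum_perm_root_pow_mul_conj_self, sum_perm_root_pow_mul_conj_self]
    · have hb' : (b : ℂ) - 1 ≠ 0 := sub_ne_zero.2 (by exact_mod_cast hb.ne')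
      exact mul_left_cancel₀ hb' ((sum_perm_root_pow_mul_conj_of_digit_ne hc h0 ha).trans
        (sum_perm_root_pow_mul_conj_of_digit_ne hc' h0' ha).symm)
  · rw [hπ.digitCorrelation_of_word_ne hw hc hc (.inl h0),
      hπ.digitCorrelation_of_word_ne hw hc' hc' (.inl h0')]

/-- The correlation of two products of digit characters splits over the digits. -/
theorem IsUniformScrambling.integral_prod_root_pow (hπ : IsUniformScrambling P π)
    (T : Finset (Fin s × Fin d × ℕ)) (c c' : Fin s × Fin d × ℕ → ℕ) :
    ∫ ω, (∏ t ∈ T, root b ^ (c t * (scrambledDigits π u ω t : ℕ))) *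
      (starRingEnd ℂ) (∏ t ∈ T, root b ^ (c' t * (scrambledDigits π u' ω t : ℕ))) ∂P =
      ∏ t ∈ T, digitCorrelation P π u u' t (c t) (c' t) := by
  simp_rw [map_prod, ← Finset.prod_mul_distrib]
  exact hπ.integral_prod T _ _ (fun t => by simp) (fun t => by simp) (fun t τ τ' =>
    root b ^ (c t * (τ (Real.digits (u t.1 t.2.1) b t.2.2) : ℕ)) *
    (starRingEnd ℂ) (root b ^ (c' t * (τ' (Real.digits (u' t.1 t.2.1) b t.2.2) : ℕ))))

end Scrambling

/-! ### From digit sequences to points of the cube -/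

section CubePoint

variable {b d s : ℕ}

/-- The uniform distribution on the sequences of digits of `d * s` coordinates. -/
noncomputable def digitsMeasure (b d s : ℕ) [NeZero b] : Measure (Fin s × Fin d × ℕ → Fin b) :=
  Measure.infinitePi fun _ => digitMeasure b

instance [NeZero b] : IsProbabilityMeasure (digitsMeasure b d s) := by
  unfold digitsMeasure; infer_instance

/-- The point of `[0,1]^s` obtained by interlacing the digits of `d * s` coordinates. -/
noncomputable def cubePoint [NeZero d] (x : Fin s × Fin d × ℕ → Fin b) (i : Fin s) : ℝ :=
  Real.ofDigits fun n : ℕ => x (i, Fin.ofNat d n, n / d)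

theorem interlace_index_injective (d : ℕ) [NeZero d] :
    Function.Injective fun n : ℕ => (Fin.ofNat d n, n / d) := by
  intro n n' h
  simp only [Prod.mk.injEq] at h
  have h1 := congrArg Fin.val h.1
  rw [Fin.val_ofNat, Fin.val_ofNat] at h1
  rw [← Nat.div_add_mod n d, ← Nat.div_add_mod n' d, h1, h.2]

/-- Interlacing is an injective reindexing of i.i.d. digits, hence gives i.i.d. digits again;
`Real.ofDigits` then makes each coordinate uniform. -/
theorem measurePreserving_cubePoint (hb : 1 < b) [NeZero b] [NeZero d] :
    MeasurePreserving (cubePoint (b := b) (d := d) (s := s)) (digitsMeasure b d s)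
      (volume.restrict (Set.Icc (0 : Fin s → ℝ) 1)) := by
  have h1 : (digitsMeasure b d s).map (fun x (p : Fin s × ℕ) => x (p.1, Fin.ofNat d p.2, p.2 / d)) =
      Measure.infinitePi fun _ : Fin s × ℕ => digitMeasure b :=
    Measure.map_infinitePi_infinitePi_of_inj (P := fun _ => digitMeasure b)
      (f := fun p : Fin s × ℕ => (p.1, Fin.ofNat d p.2, p.2 / d)) (by
        rintro ⟨i, n⟩ ⟨i', n'⟩ h
        simp only [Prod.mk.injEq] at h
        rw [h.1, interlace_index_injective d (Prod.ext h.2.1 h.2.2)])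
  have h2 := Measure.infinitePi_map_curry fun (_ : Fin s) (_ : ℕ) => digitMeasure b
  have hm : Measurable fun (x : Fin s × Fin d × ℕ → Fin b) (p : Fin s × ℕ) =>
      x (p.1, Fin.ofNat d p.2, p.2 / d) :=
    measurable_pi_lambda _ fun _ => measurable_pi_apply _
  rw [← h1, Measure.map_map (MeasurableEquiv.measurable _) hm, Measure.infinitePi_eq_pi] at h2
  have hof : MeasurePreserving (Real.ofDigits (b := b))
      (Measure.infinitePi fun _ : ℕ => digitMeasure b) (volume.restrict (Set.Icc (0 : ℝ) 1)) :=
    ⟨Real.continuous_ofDigits.measurable, map_ofDigits hb⟩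
  have h3 := measurePreserving_pi (fun _ : Fin s => Measure.infinitePi fun _ : ℕ => digitMeasure b)
    (fun _ => volume.restrict (Set.Icc (0 : ℝ) 1)) fun _ => hof
  rw [← Measure.restrict_pi_pi, Set.pi_univ_Icc, ← volume_pi] at h3
  exact h3.comp ⟨(MeasurableEquiv.curry (Fin s) ℕ (Fin b)).measurable.comp hm, h2⟩

/-- The digit sequences of every coordinate have infinitely many digits different from `b - 1`. -/
def IsExpansion (x : Fin s × Fin d × ℕ → Fin b) : Prop :=
  ∀ i r N, ∃ j, N ≤ j ∧ (x (i, r, j) : ℕ) + 1 ≠ b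

theorem ae_isExpansion (hb : 1 < b) [NeZero b] : ∀ᵐ x ∂(digitsMeasure b d s), IsExpansion x := by
  simp only [IsExpansion, ae_all_iff]
  intro i r
  have h1 : (digitsMeasure b d s).map (fun x (j : ℕ) => x (i, r, j)) =
      Measure.infinitePi fun _ : ℕ => digitMeasure b :=
    Measure.map_infinitePi_infinitePi_of_inj (P := fun _ => digitMeasure b)
      (f := fun j : ℕ => (i, r, j)) (fun j j' h => by simpa using h)
  have h2 := ae_exists_digit_ne hb
  rw [← h1] at h2
  exact ae_all_iff.1 (ae_of_ae_map
    (measurable_pi_lambda _ fun _ => measurable_pi_apply _).aemeasurable h2)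

variable [NeZero b] [NeZero d]

theorem digits_cubePoint {x : Fin s × Fin d × ℕ → Fin b} (hx : IsExpansion x) (i : Fin s) :
    Real.digits (cubePoint x i) b = fun n => x (i, Fin.ofNat d n, n / d) := by
  refine digits_ofDigits _ fun N => ?_
  -- One of the `d` interlaced sequences suffices; its digit `j` sits at position `j * d`.
  obtain ⟨j, hj, h⟩ := hx i 0 N
  have hd := NeZero.pos d
  refine ⟨j * d, hj.trans (Nat.le_mul_of_pos_right j hd), ?_⟩
  have : Fin.ofNat d (j * d) = 0 := by ext; simp
  rwa [this, Nat.mul_div_cancel _ hd]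

theorem walsh_eq_prod (hb : 1 < b) {k L : ℕ} (h : k < b ^ L) (x : ℝ) :
    walsh b k x = ∏ j ∈ Finset.range L, root b ^ (k / b ^ j % b * (Real.digits x b j : ℕ)) := by
  rw [walsh, sum_digits_length_eq hb h (fun c j => c * (Real.digits x b j : ℕ)) (by simp),
    ← Finset.prod_pow_eq_pow_sum]
  rfl

theorem prod_range_mul_add {M : Type*} [CommMonoid M] (d L : ℕ) (g : ℕ → M) :
    ∏ n ∈ Finset.range (L * d), g n =
      ∏ r : Fin d, ∏ a ∈ Finset.range L, g ((r : ℕ) + a * d) :=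
  sum_range_mul_add (M := Additive M) d L g

/-- Interlacing of indices and interlacing of points use the same reordering of digit positions, so
the digit pairing in the exponent is only rearranged. -/
theorem walshProd_cubePoint (hb : 1 < b) {x : Fin s × Fin d × ℕ → Fin b} (hx : IsExpansion x)
    (k : Fin s → Fin d → ℕ) :
    walshProd b (fun i => interlaceNat b (k i)) (cubePoint x) = digitWalsh k x := by
  rw [walshProd, digitWalsh, box, Finset.prod_product]
  refine Finset.prod_congr rfl fun i _ => ?_
  rw [walsh_eq_prod hb (interlaceNat_lt hb _ (lt_pow_sum hb k i)), prod_range_mul_add,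
    Finset.prod_product]
  refine Finset.prod_congr rfl fun r _ => Finset.prod_congr rfl fun a _ => ?_
  have h1 : Fin.ofNat d ((r : ℕ) + a * d) = r := by
    ext; rw [Fin.val_ofNat, Nat.add_mul_mod_self_right, Nat.mod_eq_of_lt r.isLt]
  have h2 : ((r : ℕ) + a * d) / d = a := by
    rw [Nat.add_mul_div_right _ _ (NeZero.pos d), Nat.div_eq_of_lt r.isLt, zero_add]
  simp only [interlaceNat_div_mod hb, digits_cubePoint hx, h1, h2]
  rfl

end CubePoint

/-! ### Scrambled points and gain coefficients -/

section ScrambledPoints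

theorem mem_block {b s d : ℕ} {l k : Fin s → Fin d → ℕ} :
    k ∈ block b l ↔ ∀ i r, b ^ l i r / b ≤ k i r ∧ k i r < b ^ l i r := by
  simp [block]

variable {Ω : Type*} {b d s : ℕ} [NeZero b]
  {π : Fin s → Fin d → List (Fin b) → Ω → Equiv.Perm (Fin b)}

theorem digits_scramble {u : Fin s → Fin d → ℝ} {ω : Ω} (h : IsExpansion (scrambledDigits π u ω))
    (i : Fin s) (r : Fin d) :
    Real.digits (scramble (fun w => π i r w ω) (u i r)) b =
      fun j => scrambledDigits π u ω (i, r, j) :=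
  digits_ofDigits _ (h i r)

/-- Interlacing rereads the digits of the scrambled numbers. They are the permuted digits provided
no sequence ends in `b - 1` forever, hence the assumption, which holds almost surely. -/
theorem scrambleOrder_eq_cubePoint [NeZero d] {x : Fin s → ℝ} {ω : Ω}
    (h : IsExpansion (scrambledDigits π (fun i => deinterlace b d (x i)) ω)) :
    scrambleOrder (fun i r w => π i r w ω) x =
      cubePoint (scrambledDigits π (fun i => deinterlace b d (x i)) ω) := by
  funext i
  unfold scrambleOrder interlace cubePoint scramblePoint
  congr 1
  funext n
  rw [digits_scramble (u := fun i => deinterlace b d (x i)) h]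

theorem walshProd_scramblePoint (hb : 1 < b) {u : Fin s → Fin d → ℝ} {ω : Ω}
    (h : IsExpansion (scrambledDigits π u ω)) {k : Fin s → Fin d → ℕ} {L : ℕ}
    (hk : ∀ i r, k i r < b ^ L) (i : Fin s) :
    walshProd b (k i) (scramblePoint (fun r w => π i r w ω) (u i)) =
      ∏ t ∈ {i} ×ˢ Finset.univ ×ˢ Finset.range L,
        root b ^ (digit b k t * (scrambledDigits π u ω t : ℕ)) := by
  rw [walshProd, Finset.prod_product, Finset.prod_singleton, Finset.prod_product]
  refine Finset.prod_congr rfl fun r _ => ?_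
  rw [walsh_eq_prod hb (hk i r)]
  unfold scramblePoint
  rw [digits_scramble h]
  rfl

variable [MeasurableSpace Ω] {P : Measure Ω}

theorem IsUniformScrambling.ae_isExpansion (hπ : IsUniformScrambling P π) [IsProbabilityMeasure P]
    (hb : 1 < b) (u : Fin s → Fin d → ℝ) : ∀ᵐ ω ∂P, IsExpansion (scrambledDigits π u ω) := by
  have h := OwenNet.ae_isExpansion (d := d) (s := s) hb
  rw [digitsMeasure, ← hπ.map_scrambledDigits u] at h
  exact ae_of_ae_map (hπ.measurable_scrambledDigits u).aemeasurable h

theorem gain_eq (hπ : IsUniformScrambling P π) [IsProbabilityMeasure P] (hb : 1 < b) {N : ℕ}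
    (x : Fin N → Fin s → ℝ) {k : Fin s → Fin d → ℕ} {L : ℕ} (hk : ∀ i r, k i r < b ^ L) :
    gain P π x k = (1 / (N : ℂ) ^ 2) * ∑ n, ∑ n', ∏ t ∈ box s d L,
      digitCorrelation P π (fun i => deinterlace b d (x n i)) (fun i => deinterlace b d (x n' i)) t
        (digit b k t) (digit b k t) := by
  unfold gain
  congr 1
  refine Finset.sum_congr rfl fun n _ => Finset.sum_congr rfl fun n' _ => ?_
  rw [box, Finset.prod_product]
  refine Finset.prod_congr rfl fun i _ => ?_
  refine Eq.trans ?_ ((hπ.integral_prod_root_pow ({i} ×ˢ Finset.univ ×ˢ Finset.range L)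
    (digit b k) (digit b k)).trans (by rw [Finset.prod_product, Finset.prod_singleton]))
  refine integral_congr_ae ?_
  filter_upwards [hπ.ae_isExpansion hb fun i => deinterlace b d (x n i),
    hπ.ae_isExpansion hb fun i => deinterlace b d (x n' i)] with ω h h'
  rw [walshProd_scramblePoint hb h hk, walshProd_scramblePoint hb h' hk]

/-- Only the leading position `l` survives. Above it the digits vanish. If the points agree before
`l`, all lower factors are one; otherwise their words at `l` differ and the factor at `l` is zero,
as is the right side. -/
theorem prod_digitCorrelation_eq (hπ : IsUniformScrambling P π) [IsProbabilityMeasure P]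
    (hb : 1 < b) (u u' : Fin s → Fin d → ℝ) (i : Fin s) (r : Fin d) {c : ℕ → ℕ} {l L : ℕ}
    (hc : ∀ j, c j < b) (hl : c l ≠ 0) (h0 : ∀ j, l < j → c j = 0) (hL : l < L) :
    ∏ j ∈ Finset.range L, digitCorrelation P π u u' (i, r, j) (c j) (c j) =
      digitCorrelation P π u u' (i, r, l) 1 1 := by
  have h1 : ∏ j ∈ Finset.range L, digitCorrelation P π u u' (i, r, j) (c j) (c j) =
      ∏ j ∈ Finset.range (l + 1), digitCorrelation P π u u' (i, r, j) (c j) (c j) := by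
    symm
    refine Finset.prod_subset (Finset.range_mono hL) fun j _ hj => ?_
    rw [h0 j (by simpa using hj), digitCorrelation_zero]
  rw [h1, Finset.prod_range_succ, hπ.digitCorrelation_eq_of_ne_zero hb (hc l) hb hl one_ne_zero]
  by_cases hw : ∀ j < l, Real.digits (u i r) b j = Real.digits (u' i r) b j
  · rw [Finset.prod_eq_one, one_mul]
    exact fun j hj => hπ.digitCorrelation_of_digits_eq
      (fun j' hj' => hw j' (hj'.trans_lt (Finset.mem_range.1 hj))) _
  · rw [hπ.digitCorrelation_of_word_ne _ hb hb (.inl one_ne_zero), mul_zero]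
    intro h
    refine hw fun j hj => ?_
    exact List.map_inj_left.1 h j (List.mem_range.2 hj)

theorem div_pow_pred_mod_ne_zero {k l : ℕ} (hl : l ≠ 0) (h1 : b ^ l / b ≤ k)
    (h2 : k < b ^ l) : k / b ^ (l - 1) % b ≠ 0 := by
  obtain ⟨l, rfl⟩ := Nat.exists_eq_succ_of_ne_zero hl
  have hb := NeZero.pos b
  rw [Nat.succ_eq_add_one, pow_succ, Nat.mul_div_cancel _ hb] at h1
  rw [Nat.succ_sub_one, Nat.mod_eq_of_lt]
  · exact (Nat.div_pos h1 (by positivity)).ne'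
  · exact Nat.div_lt_of_lt_mul (by rwa [pow_succ] at h2)

theorem gain_eq_of_mem_block (hπ : IsUniformScrambling P π) [IsProbabilityMeasure P] (hb : 1 < b)
    {N : ℕ} (x : Fin N → Fin s → ℝ) {l k k' : Fin s → Fin d → ℕ} (hk : k ∈ block b l)
    (hk' : k' ∈ block b l) : gain P π x k = gain P π x k' := by
  rw [mem_block] at hk hk'
  set L := ∑ i, ∑ r, l i r with hL
  have hlL (i : Fin s) (r : Fin d) : l i r ≤ L :=
    (Finset.single_le_sum (f := fun r => l i r) (fun _ _ => Nat.zero_le _)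
      (Finset.mem_univ r)).trans
    (Finset.single_le_sum (f := fun i => ∑ r, l i r) (fun _ _ => Nat.zero_le _)
      (Finset.mem_univ i))
  have hkL {k : Fin s → Fin d → ℕ} (hk : ∀ i r, b ^ l i r / b ≤ k i r ∧ k i r < b ^ l i r) (i r) :
      k i r < b ^ L := (hk i r).2.trans_le (Nat.pow_le_pow_right (by omega) (hlL i r))
  rw [gain_eq hπ hb x (hkL hk), gain_eq hπ hb x (hkL hk')]
  congr 1
  refine Finset.sum_congr rfl fun n _ => Finset.sum_congr rfl fun n' _ => ?_
  simp only [box, Finset.prod_product]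
  refine Finset.prod_congr rfl fun i _ => Finset.prod_congr rfl fun r _ => ?_
  -- Length zero forces the index to be zero; otherwise its leading digit is at position `l i r -
  -- 1`.
  rcases eq_or_ne (l i r) 0 with h0 | h0
  · have hz {k : Fin s → Fin d → ℕ} (hk : ∀ i r, b ^ l i r / b ≤ k i r ∧ k i r < b ^ l i r) :
        k i r = 0 := by
      have := (hk i r).2
      rw [h0, pow_zero] at this
      omega
    simp [digit, hz hk, hz hk']
  · have hprod {k : Fin s → Fin d → ℕ} (hk : ∀ i r, b ^ l i r / b ≤ k i r ∧ k i r < b ^ l i r) :=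
      prod_digitCorrelation_eq hπ hb (fun i => deinterlace b d (x n i))
        (fun i => deinterlace b d (x n' i)) i r (c := fun j => digit b k (i, r, j))
        (l := l i r - 1) (L := L) (fun j => digit_lt _ _)
        (div_pow_pred_mod_ne_zero h0 (hk i r).1 (hk i r).2)
        (fun j hj => div_pow_mod_eq_zero hb (hk i r).2 (by simp only; omega)) (by have := hlL i r; omega)
    rw [hprod hk, hprod hk']

end ScrambledPoints

/-! ### Diagonal expansion in the Walsh basis -/

section Expansion

open scoped InnerProductSpace in
/-- Expansion of a sesquilinear form that is diagonal in a Hilbert basis. -/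
theorem hasSum_inner_of_diagonal {ι H K : Type*} [NormedAddCommGroup H] [InnerProductSpace ℂ H]
    [NormedAddCommGroup K] [InnerProductSpace ℂ K] (B : HilbertBasis ι ℂ H) (S T : H →L[ℂ] K)
    (h : ∀ i j, i ≠ j → ⟪S (B i), T (B j)⟫_ℂ = 0) (x : H) :
    HasSum (fun i => ((‖⟪B i, x⟫_ℂ‖ ^ 2 : ℝ) : ℂ) * ⟪S (B i), T (B i)⟫_ℂ) ⟪S x, T x⟫_ℂ := by
  have hx := B.hasSum_repr x
  have h1 (i : ι) : ⟪S x, T (B i)⟫_ℂ =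
      (starRingEnd ℂ) ⟪B i, x⟫_ℂ * ⟪S (B i), T (B i)⟫_ℂ := by
    have h2 := (hx.mapL S).mapL (innerSL ℂ (T (B i)))
    -- Expanding `x` inside `S` and pairing with `T (B i)` leaves a single term; the outer expansion
    -- inside `T` then gives the diagonal sum.
    have h3 := h2.unique (hasSum_single i fun j hj => by
      rw [map_smul, innerSL_apply_apply, inner_smul_right, ← inner_conj_symm, h j i hj, map_zero,
        mul_zero])
    rw [innerSL_apply_apply, map_smul, innerSL_apply_apply, inner_smul_right,
      B.repr_apply_apply] at h3
    rw [← inner_conj_symm, h3, map_mul, inner_conj_symm (S (B i))]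
  have h4 := (hx.mapL T).mapL (innerSL ℂ (S x))
  rw [innerSL_apply_apply] at h4
  convert! h4 using 1
  funext i
  rw [map_smul, innerSL_apply_apply, inner_smul_right, h1, B.repr_apply_apply, ← mul_assoc,
    Complex.mul_conj']
  push_cast
  rfl

variable {Ω : Type*} [MeasurableSpace Ω] {P : Measure Ω} {b d s : ℕ}

open scoped InnerProductSpace in
theorem inner_compMeasurePreserving_digitWalshLp {μ : Measure (Fin s × Fin d × ℕ → Fin b)}
    [IsFiniteMeasure μ] {Z Z' : Ω → Fin s × Fin d × ℕ → Fin b} (hZ : MeasurePreserving Z P μ)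
    (hZ' : MeasurePreserving Z' P μ) (k k' : Fin s → Fin d → ℕ) :
    ⟪Lp.compMeasurePreservingₗᵢ ℂ Z' hZ' (digitWalshLp μ k'),
      Lp.compMeasurePreservingₗᵢ ℂ Z hZ (digitWalshLp μ k)⟫_ℂ =
      ∫ ω, digitWalsh k (Z ω) * (starRingEnd ℂ) (digitWalsh k' (Z' ω)) ∂P := by
  rw [L2.inner_def]
  refine integral_congr_ae ?_
  filter_upwards [Lp.coeFn_compMeasurePreserving (digitWalshLp μ k) hZ,
    Lp.coeFn_compMeasurePreserving (digitWalshLp μ k') hZ',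
    hZ.quasiMeasurePreserving.ae_eq_comp (coeFn_digitWalshLp μ k),
    hZ'.quasiMeasurePreserving.ae_eq_comp (coeFn_digitWalshLp μ k')] with ω h1 h2 h3 h4
  have h5 := h1.trans h3
  have h6 := h2.trans h4
  change ⟪Lp.compMeasurePreserving Z' hZ' (digitWalshLp μ k') ω,
    Lp.compMeasurePreserving Z hZ (digitWalshLp μ k) ω⟫_ℂ = _
  rw [h5, h6]
  rfl

variable [NeZero b] {π : Fin s → Fin d → List (Fin b) → Ω → Equiv.Perm (Fin b)}

theorem IsUniformScrambling.measurePreserving_scrambledDigits (hπ : IsUniformScrambling P π)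
    [IsProbabilityMeasure P] (u : Fin s → Fin d → ℝ) :
    MeasurePreserving (scrambledDigits π u) P (digitsMeasure b d s) :=
  ⟨hπ.measurable_scrambledDigits u, hπ.map_scrambledDigits u⟩

theorem IsUniformScrambling.integral_digitWalsh_mul_conj (hπ : IsUniformScrambling P π)
    [IsProbabilityMeasure P] (hb : 1 < b) (u u' : Fin s → Fin d → ℝ) {k k' : Fin s → Fin d → ℕ}
    {L : ℕ} (hk : ∀ i r, k i r < b ^ L) (hk' : ∀ i r, k' i r < b ^ L) :
    ∫ ω, digitWalsh k (scrambledDigits π u ω) *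
      (starRingEnd ℂ) (digitWalsh k' (scrambledDigits π u' ω)) ∂P =
      ∏ t ∈ box s d L, digitCorrelation P π u u' t (digit b k t) (digit b k' t) := by
  rw [← hπ.integral_prod_root_pow]
  simp_rw [digitWalsh_eq hb fun t ht => digit_eq_zero (t := t) hb hk ht,
    digitWalsh_eq hb fun t ht => digit_eq_zero (t := t) hb hk' ht]

theorem IsUniformScrambling.integral_digitWalsh_mul_conj_of_ne (hπ : IsUniformScrambling P π)
    [IsProbabilityMeasure P] (hb : 1 < b) (u u' : Fin s → Fin d → ℝ) {k k' : Fin s → Fin d → ℕ}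
    (h : k ≠ k') :
    ∫ ω, digitWalsh k (scrambledDigits π u ω) *
      (starRingEnd ℂ) (digitWalsh k' (scrambledDigits π u' ω)) ∂P = 0 := by
  have h1 := fun i r => (lt_pow_sum hb k i r).trans_le
    (Nat.pow_le_pow_right (by omega) (Nat.le_add_right _ (∑ i, ∑ r, k' i r)))
  have h2 := fun i r => (lt_pow_sum hb k' i r).trans_le
    (Nat.pow_le_pow_right (by omega) (Nat.le_add_left _ (∑ i, ∑ r, k i r)))
  rw [hπ.integral_digitWalsh_mul_conj hb u u' h1 h2]
  obtain ⟨t, ht⟩ : ∃ t, digit b k t ≠ digit b k' t := by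
    by_contra! hcon
    exact h (eq_of_digit_eq hb hcon)
  refine Finset.prod_eq_zero (i := t) ?_
    (hπ.digitCorrelation_of_ne (digit_lt k t) (digit_lt k' t) ht)
  by_contra hbox
  exact ht ((digit_eq_zero hb h1 hbox).trans (digit_eq_zero hb h2 hbox).symm)

/-- Scrambling the origin realises `digitsMeasure` as a law under `P`, so the inner products are
correlations of characters at one scrambled point. -/
theorem IsUniformScrambling.orthonormal_digitWalshLp (hπ : IsUniformScrambling P π)
    [IsProbabilityMeasure P] (hb : 1 < b) : Orthonormal ℂ (digitWalshLp (digitsMeasure b d s)) := by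
  classical
  have hZ := hπ.measurePreserving_scrambledDigits 0
  rw [orthonormal_iff_ite]
  intro k' k
  rw [← (Lp.compMeasurePreservingₗᵢ ℂ _ hZ).inner_map_map,
    inner_compMeasurePreserving_digitWalshLp]
  split_ifs with h
  · subst h
    simp_rw [Complex.mul_conj', norm_digitWalsh]
    simp
  · exact hπ.integral_digitWalsh_mul_conj_of_ne hb _ _ (Ne.symm h)

/-- The Walsh functions as a Hilbert basis. -/
noncomputable def IsUniformScrambling.walshBasis (hπ : IsUniformScrambling P π)
    [IsProbabilityMeasure P] (hb : 1 < b) :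
    HilbertBasis (Fin s → Fin d → ℕ) ℂ (Lp ℂ 2 (digitsMeasure b d s)) :=
  HilbertBasis.mk (hπ.orthonormal_digitWalshLp hb)
    (span_digitWalshLp_closure_eq_top hb (digitsMeasure b d s)).ge

theorem IsUniformScrambling.walshBasis_apply (hπ : IsUniformScrambling P π)
    [IsProbabilityMeasure P] (hb : 1 < b) (k : Fin s → Fin d → ℕ) :
    hπ.walshBasis hb k = digitWalshLp (digitsMeasure b d s) k := by
  simp [IsUniformScrambling.walshBasis]

theorem measurable_walsh (k : ℕ) : Measurable (walsh b k) := by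
  unfold walsh
  refine (measurable_from_top (f := fun n : ℕ => Complex.exp (2 * Real.pi * Complex.I / b) ^ n)).comp
    (Finset.measurable_fun_sum _ fun j _ => ?_)
  exact (measurable_from_top (f := fun c : Fin b => (k / b ^ j % b) * (c : ℕ))).comp
    (measurable_digits j)

theorem measurable_walshProd {n : ℕ} (k : Fin n → ℕ) : Measurable (walshProd b k) :=
  Finset.measurable_fun_prod _ fun i _ => (measurable_walsh (k i)).comp (measurable_pi_apply i)

theorem walshCoeff_interlaceNat [NeZero d] (hb : 1 < b) {f : (Fin s → ℝ) → ℝ}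
    (hf : AEStronglyMeasurable f (volume.restrict (Set.Icc (0 : Fin s → ℝ) 1)))
    (k : Fin s → Fin d → ℕ) :
    walshCoeff b f (fun i => interlaceNat b (k i)) =
      ∫ x, (f (cubePoint x) : ℂ) * (starRingEnd ℂ) (digitWalsh k x) ∂(digitsMeasure b d s) := by
  have hc := measurePreserving_cubePoint (d := d) (s := s) hb
  have hw := measurable_walshProd (b := b) fun i => interlaceNat b (k i)
  rw [walshCoeff, ← hc.map_eq, integral_map hc.measurable.aemeasurable]
  · refine integral_congr_ae ?_
    filter_upwards [ae_isExpansion hb] with x hx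
    rw [walshProd_cubePoint hb hx]
  · rw [hc.map_eq]
    exact (Complex.continuous_ofReal.comp_aestronglyMeasurable hf).mul
      (Complex.continuous_conj.measurable.comp hw).aestronglyMeasurable

open scoped InnerProductSpace in
theorem inner_digitWalshLp_toLp [NeZero d] (hb : 1 < b) {f : (Fin s → ℝ) → ℝ}
    (hf : AEStronglyMeasurable f (volume.restrict (Set.Icc (0 : Fin s → ℝ) 1)))
    (hF : MemLp (fun x => (f (cubePoint x) : ℂ)) 2 (digitsMeasure b d s))
    (k : Fin s → Fin d → ℕ) :
    ⟪digitWalshLp (digitsMeasure b d s) k, hF.toLp _⟫_ℂ =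
      walshCoeff b f (fun i => interlaceNat b (k i)) := by
  rw [walshCoeff_interlaceNat hb hf, L2.inner_def]
  refine integral_congr_ae ?_
  filter_upwards [hF.coeFn_toLp, coeFn_digitWalshLp (digitsMeasure b d s) k] with x h1 h2
  rw [h1, h2]
  rfl

open scoped InnerProductSpace in
/-- The correlation of `f` at two scrambled points in terms of its Walsh coefficients. -/
theorem IsUniformScrambling.hasSum_integral_mul [NeZero d] (hπ : IsUniformScrambling P π)
    [IsProbabilityMeasure P] (hb : 1 < b) {f : (Fin s → ℝ) → ℝ}
    (hf : MemLp f 2 (volume.restrict (Set.Icc (0 : Fin s → ℝ) 1))) (u u' : Fin s → Fin d → ℝ) :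
    HasSum (fun k : Fin s → Fin d → ℕ =>
      ((‖walshCoeff b f (fun i => interlaceNat b (k i))‖ ^ 2 : ℝ) : ℂ) *
        ∏ t ∈ box s d (∑ i, ∑ r, k i r),
          digitCorrelation P π u u' t (digit b k t) (digit b k t))
      ((∫ ω, f (cubePoint (scrambledDigits π u ω)) *
        f (cubePoint (scrambledDigits π u' ω)) ∂P : ℝ) : ℂ) := by
  have hF : MemLp (fun x => (f (cubePoint x) : ℂ)) 2 (digitsMeasure b d s) :=
    (hf.comp_measurePreserving (measurePreserving_cubePoint hb)).ofReal
  have hZ := hπ.measurePreserving_scrambledDigits u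
  have hZ' := hπ.measurePreserving_scrambledDigits u'
  -- The inner product is conjugate linear in its first argument, so the isometry of `u'` comes
  -- first.
  have h := hasSum_inner_of_diagonal (hπ.walshBasis hb)
    (Lp.compMeasurePreservingₗᵢ ℂ _ hZ').toContinuousLinearMap
    (Lp.compMeasurePreservingₗᵢ ℂ _ hZ).toContinuousLinearMap (fun k' k hk => by
      rw [hπ.walshBasis_apply, hπ.walshBasis_apply]
      refine (inner_compMeasurePreserving_digitWalshLp hZ hZ' k k').trans ?_
      exact hπ.integral_digitWalsh_mul_conj_of_ne hb _ _ hk.symm) (hF.toLp _)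
  convert! h using 1
  · funext k
    rw [hπ.walshBasis_apply, inner_digitWalshLp_toLp hb hf.aestronglyMeasurable]
    congr 1
    refine Eq.trans ?_ (inner_compMeasurePreserving_digitWalshLp hZ hZ' k k).symm
    exact (hπ.integral_digitWalsh_mul_conj hb u u' (lt_pow_sum hb k) (lt_pow_sum hb k)).symm
  · rw [← integral_complex_ofReal]
    change _ = ⟪Lp.compMeasurePreserving _ hZ' (hF.toLp _),
      Lp.compMeasurePreserving _ hZ (hF.toLp _)⟫_ℂ
    rw [Lp.toLp_compMeasurePreserving, Lp.toLp_compMeasurePreserving, L2.inner_def]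
    refine integral_congr_ae ?_
    filter_upwards [(hF.comp_measurePreserving hZ).coeFn_toLp,
      (hF.comp_measurePreserving hZ').coeFn_toLp] with ω h1 h2
    rw [h1, h2]
    simp [RCLike.inner_apply]

end Expansion

/-! ### Regrouping the index set into blocks -/

section Blocks

variable {b d s : ℕ}

theorem block_bijective (hb : 1 < b) :
    Function.Bijective fun p : Σ l : Fin s → Fin d → ℕ, block b l => (p.2 : Fin s → Fin d → ℕ) := by
  have key {l l' k : ℕ} (h1 : k < b ^ l) (h2 : b ^ l' / b ≤ k) : l' ≤ l := by
    by_contra! hlt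
    obtain ⟨c, rfl⟩ := Nat.exists_eq_add_of_lt hlt
    rw [pow_succ, Nat.mul_div_cancel _ (by omega)] at h2
    exact absurd (h1.trans_le (Nat.pow_le_pow_right (by omega) (Nat.le_add_right l c))) (by omega)
  constructor
  · rintro ⟨l, k, hk⟩ ⟨l', k', hk'⟩ h
    simp only at h
    subst h
    have : l = l' := by
      funext i r
      rw [mem_block] at hk hk'
      exact le_antisymm (key (hk' i r).2 (hk i r).1) (key (hk i r).2 (hk' i r).1)
    subst this
    rfl
  · intro k
    -- The block of `k` is given by the number of base `b` digits of each entry.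
    refine ⟨⟨fun i r => if k i r = 0 then 0 else Nat.log b (k i r) + 1, k,
      mem_block.2 fun i r => ?_⟩, rfl⟩
    split_ifs with h
    · simp [h, Nat.div_eq_of_lt hb]
    · rw [pow_succ, Nat.mul_div_cancel _ (by omega), ← pow_succ]
      exact ⟨Nat.pow_log_le_self b h, Nat.lt_pow_succ_log_self hb _⟩

theorem hasSum_block {M : Type*} [AddCommGroup M] [TopologicalSpace M] [IsTopologicalAddGroup M]
    (hb : 1 < b) {g : (Fin s → Fin d → ℕ) → M} {a : M} (h : HasSum g a) :
    HasSum (fun l => ∑ k ∈ block b l, g k) a := by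
  have h1 := (Equiv.ofBijective _ (block_bijective (s := s) (d := d) hb)).hasSum_iff.2 h
  exact h1.sigma fun l => (block b l).hasSum g

theorem hasSum_subtype_ne {ι M : Type*} [AddCommGroup M] [TopologicalSpace M]
    [IsTopologicalAddGroup M] {g : ι → M} {a : M} (h : HasSum g a) (i : ι) :
    HasSum (fun j : {j // j ≠ i} => g j) (a - g i) := by
  classical
  have h1 := h.sub (hasSum_ite_eq i (g i))
  refine (hasSum_subtype_iff_indicator (s := {j | j ≠ i})).2 ?_
  convert! h1 using 1
  funext j
  by_cases hj : j = i
  · simp [hj]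
  · simp [hj]

end Blocks

/-! ### The variance of the estimator -/

section Variance

variable {Ω : Type*} [MeasurableSpace Ω] {P : Measure Ω} [IsProbabilityMeasure P]

theorem variance_average {N : ℕ} (hN : N ≠ 0) {X : Ω → ℝ} {Y : Fin N → Ω → ℝ} {c : ℝ}
    (hY : ∀ n, MemLp (Y n) 2 P) (hc : ∀ n, ∫ ω, Y n ω ∂P = c)
    (hX : X =ᵐ[P] fun ω => (1 / (N : ℝ)) * ∑ n, Y n ω) :
    MemLp X 2 P ∧
      variance X P = (1 / (N : ℝ) ^ 2) * ∑ n, ∑ n', ∫ ω, Y n ω * Y n' ω ∂P - c ^ 2 := by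
  have hN' : (N : ℝ) ≠ 0 := Nat.cast_ne_zero.2 hN
  have hS : MemLp (fun ω => (1 / (N : ℝ)) * ∑ n, Y n ω) 2 P :=
    (memLp_finsetSum _ fun n _ => hY n).const_mul _
  refine ⟨hS.ae_eq hX.symm, ?_⟩
  have h1 : ∫ ω, (1 / (N : ℝ)) * ∑ n, Y n ω ∂P = c := by
    rw [integral_const_mul, integral_finsetSum _ fun n _ => (hY n).integrable one_le_two]
    simp [hc, hN']
  rw [variance_congr hX, variance_eq_sub hS, h1]
  congr 1
  have h2 (ω : Ω) : ((fun ω => (1 / (N : ℝ)) * ∑ n, Y n ω) ^ 2) ω =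
      (1 / (N : ℝ) ^ 2) * ∑ n, ∑ n', Y n ω * Y n' ω := by
    rw [Pi.pow_apply, mul_pow, sq (∑ n, Y n ω), Finset.sum_mul_sum]
    ring
  simp_rw [h2]
  have hint (n n' : Fin N) : Integrable (fun ω => Y n ω * Y n' ω) P :=
    (hY n).integrable_mul (hY n')
  rw [integral_const_mul, integral_finsetSum _ fun n _ => integrable_finsetSum _ fun n' _ =>
    hint n n']
  congr 1
  refine Finset.sum_congr rfl fun n _ => ?_
  rw [integral_finsetSum _ fun n' _ => hint n n']

variable {b d s : ℕ} [NeZero b] [NeZero d]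
  {π : Fin s → Fin d → List (Fin b) → Ω → Equiv.Perm (Fin b)}

/-- The variance of the estimator for scrambled points of order `d`, for arbitrary points. -/
theorem IsUniformScrambling.hasSum_variance_estimator (hπ : IsUniformScrambling P π) (hb : 1 < b)
    {N : ℕ} (hN : N ≠ 0) (x : Fin N → Fin s → ℝ) {f : (Fin s → ℝ) → ℝ}
    (hf : MemLp f 2 (volume.restrict (Set.Icc (0 : Fin s → ℝ) 1)))
    {k : (Fin s → Fin d → ℕ) → Fin s → Fin d → ℕ} (hk : ∀ l, k l ∈ block b l) :
    MemLp (estimator π x f) 2 P ∧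
    HasSum
      (fun l : {l : Fin s → Fin d → ℕ // l ≠ 0} => (sigmaSq b f l.1 : ℂ) * gain P π x (k l.1))
      ((variance (estimator π x f) P : ℝ) : ℂ) := by
  set u : Fin N → Fin s → Fin d → ℝ := fun n i => deinterlace b d (x n i)
  set Y : Fin N → Ω → ℝ := fun n ω => f (cubePoint (scrambledDigits π (u n) ω)) with hY
  have hFm : MemLp (fun z => f (cubePoint z)) 2 (digitsMeasure b d s) :=
    hf.comp_measurePreserving (measurePreserving_cubePoint hb)
  have hZ (n : Fin N) := hπ.measurePreserving_scrambledDigits (u n)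
  have hmean (n : Fin N) : ∫ ω, Y n ω ∂P = ∫ z, f (cubePoint z) ∂(digitsMeasure b d s) := by
    rw [← (hZ n).map_eq, integral_map (hZ n).measurable.aemeasurable]
    rw [(hZ n).map_eq]
    exact hFm.aestronglyMeasurable
  have hest : estimator π x f =ᵐ[P] fun ω => (1 / (N : ℝ)) * ∑ n, Y n ω := by
    filter_upwards [ae_all_iff.2 fun n => hπ.ae_isExpansion hb (u n)] with ω hω
    simp only [estimator, hY]
    congr 1
    exact Finset.sum_congr rfl fun n _ => by rw [scrambleOrder_eq_cubePoint (hω n)]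
  obtain ⟨hmem, hvar⟩ := variance_average hN
    (fun n => hFm.comp_measurePreserving (hZ n)) hmean hest
  refine ⟨hmem, ?_⟩
  have hN' : (N : ℂ) ≠ 0 := Nat.cast_ne_zero.2 hN
  have hsum := (hasSum_sum (s := Finset.univ) fun n _ => hasSum_sum (s := Finset.univ)
    fun n' _ => hπ.hasSum_integral_mul hb hf (u n) (u n')).mul_left (1 / (N : ℂ) ^ 2)
  have hterm (k : Fin s → Fin d → ℕ) : (1 / (N : ℂ) ^ 2) * ∑ n, ∑ n',
      (((‖walshCoeff b f (fun i => interlaceNat b (k i))‖ ^ 2 : ℝ) : ℂ) *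
        ∏ t ∈ box s d (∑ i, ∑ r, k i r),
          digitCorrelation P π (u n) (u n') t (digit b k t) (digit b k t)) =
      ((‖walshCoeff b f (fun i => interlaceNat b (k i))‖ ^ 2 : ℝ) : ℂ) * gain P π x k := by
    rw [gain_eq hπ hb x (lt_pow_sum hb k)]
    simp_rw [← Finset.mul_sum]
    ring
  simp_rw [hterm] at hsum
  have hblock := hasSum_subtype_ne (hasSum_block hb hsum) 0
  -- Constancy of the gain on a block lets it be taken out of the block sum, with the chosen
  -- representative.
  have hsig (l : Fin s → Fin d → ℕ) : ∑ k ∈ block b l,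
      ((‖walshCoeff b f (fun i => interlaceNat b (k i))‖ ^ 2 : ℝ) : ℂ) * gain P π x k =
      (sigmaSq b f l : ℂ) * gain P π x (k l) := by
    rw [sigmaSq, Complex.ofReal_sum, Finset.sum_mul]
    exact Finset.sum_congr rfl fun k' hk' => by rw [gain_eq_of_mem_block hπ hb x hk' (hk l)]
  -- The zero block is the single index `0`, with gain one and Walsh coefficient the mean of `f`;
  -- removing it cancels the squared mean in the variance.
  have hzero : ∑ k ∈ block b (0 : Fin s → Fin d → ℕ),
      ((‖walshCoeff b f (fun i => interlaceNat b (k i))‖ ^ 2 : ℝ) : ℂ) * gain P π x k =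
      (((∫ z, f (cubePoint z) ∂(digitsMeasure b d s)) ^ 2 : ℝ) : ℂ) := by
    have hbl : block b (0 : Fin s → Fin d → ℕ) = {0} := by
      ext k
      simp only [mem_block, Finset.mem_singleton, Pi.zero_apply, pow_zero, Nat.lt_one_iff]
      exact ⟨fun h => by funext i r; exact (h i r).2, fun h => by
        simp [h, Nat.div_eq_of_lt hb]⟩
    have hg : gain P π x (0 : Fin s → Fin d → ℕ) = 1 := by
      rw [gain_eq hπ hb x (L := 0) (by simp)]
      simp only [box, Finset.range_zero, Finset.product_empty, Finset.prod_empty, Finset.sum_const,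
        Finset.card_univ, Fintype.card_fin, nsmul_eq_mul, mul_one]
      field_simp
    rw [hbl, Finset.sum_singleton, hg, mul_one,
      walshCoeff_interlaceNat hb hf.aestronglyMeasurable]
    simp_rw [digitWalsh_zero, map_one, mul_one]
    rw [integral_complex_ofReal, Complex.norm_real, Real.norm_eq_abs, sq_abs]
  rw [hzero] at hblock
  simp_rw [hsig] at hblock
  convert! hblock using 1
  rw [hvar]
  push_cast
  rfl

end Variance

end OwenNet

theorem mainTheorem4 {b d s m R : ℕ} [Fact b.Prime] [NeZero d]
    (C : Fin s → Matrix (Fin R) (Fin m) (ZMod b))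
    {Ω : Type*} [MeasurableSpace Ω] (P : MeasureTheory.Measure Ω)
    [MeasureTheory.IsProbabilityMeasure P]
    (π : Fin s → Fin d → List (Fin b) → Ω → Equiv.Perm (Fin b))
    (hπ : OwenNet.IsUniformScrambling P π)
    (f : (Fin s → ℝ) → ℝ)
    (hf : MeasureTheory.MemLp f 2
      (MeasureTheory.volume.restrict (Set.Icc (0 : Fin s → ℝ) 1)))
    (k : (Fin s → Fin d → ℕ) → Fin s → Fin d → ℕ)
    (hk : ∀ l, k l ∈ OwenNet.block b l) :
    MeasureTheory.MemLp (OwenNet.estimator π (OwenNet.digitalNet C) f) 2 P ∧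
    HasSum
      (fun l : {l : Fin s → Fin d → ℕ // l ≠ 0} =>
        (OwenNet.sigmaSq b f l.1 : ℂ) * OwenNet.gain P π (OwenNet.digitalNet C) (k l.1))
      ((ProbabilityTheory.variance (OwenNet.estimator π (OwenNet.digitalNet C) f) P : ℝ) : ℂ) := by
  have hb : b.Prime := Fact.out
  exact hπ.hasSum_variance_estimator hb.one_lt (pow_pos hb.pos m).ne' _ hf hk
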